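/- All vector spaces are over $\mathbb{F}_2$ and finite dimensional. A quadratic map is a map $Q:W\to V$ with $Q(0)=0$ such that $B(x,y)=Q(x+y)+Q(x)+Q(y)$ is bilinear; a morphism $Q_1\to Q_2$ of quadratic maps $Q_i:W_i\to V_i$ is a pair of linear maps $f=(f_W:W_1\to W_2,\ f_V:V_1\to V_2)$ with $Q_2f_W=f_VQ_1$. Fix a basis $w_1,\dots,w_m$ of $W$, let $x_1,\dots,x_m$ be the dual basis, so that $H^*(W,\mathbb{F}_2)=\mathbb{F}_2[x_1,\dots,x_m]$, and let the Bockstein operator $\beta$ be the derivation of this ring with $\beta(x_i)=x_i^2$. For a functional $\varphi$ on $V$ let $q_\varphi$ be the homogeneous polynomial of degree 2 that represents the function $\varphi\circ Q$ on $W$; let $I(Q)$ be the ideal generated by all $q_\varphi$. $Q$ is Bockstein closed if $\beta(I(Q))\subseteq I(Q)$ (this does not depend on the basis). Put $A^*(Q)=\mathbb{F}_2[x_1,\dots,x_m]/I(Q)$. A $Q$-module is a vector space $U$ with linear maps $\rho_W:W\to \operatorname{End}(U)$ and $\rho_V:V\to\operatorname{End}(U)$ such that $\rho_V(Q(w))=\rho_W(w)^2+\rho_W(w)$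 for all $w\in W$. For $Q$ Bockstein closed, $H^*(Q,U)$ is the cohomology of the cochain complex $C^p(Q,U)=A^p(Q)\otimes U$ with $\delta(f)=\beta(f)+Rf$, where $R=\sum_i x_i\otimes\rho_W(w_i)$. An extension of $Q$ with abelian kernel $U$ is a sequence of morphisms $0\to U\xrightarrow{i}\widetilde Q\xrightarrow{\pi}Q\to 0$, where $U$ stands for the quadratic map $\operatorname{id}_U:U\to U$, such that the two sequences of vector spaces given by $(i_W,\pi_W)$ and $(i_V,\pi_V)$ are short exact. It induces the given action on $U$ if $i_V(\rho_W(\pi_W(x))u)=\widetilde B(i_W(u),x)$ for all $u\in U$ and all $x$ in the domain of $\widetilde Q$. Two extensions are equivalent if there is a morphism between their middle terms that is compatible with $i$ and $\pi$ (the identity on $U$ and on $Q$). For a Bockstein closed $Q$ and a $Q$-module $U$, let $\operatorname{Ext}(Q,U)$ be the set of equivalence classes of extensions of $Q$ with abelian kernel $U$ that induce the given action on $U$ and in which $\widetilde Q$ is Bockstein closed. **Proposition.** Let $Q:W\to V$ be a Bockstein closed quadratic map and $U$ a $Q$-module. The Baer sum of two extensions as above (their fibre product over $Q$ modulo the antidiagonal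 copy of $U$) is again Bockstein closed, and it makes $\operatorname{Ext}(Q,U)$ an abelian group. There is an isomorphism of groups $$H^2(Q,U)\cong \operatorname{Ext}(Q,U),$$ under which the class of an extension corresponds to the class of each of its factor sets: if $s_W$, $s_V$ are linear sections of $\pi_W$, $\pi_V$ and $\widetilde Q(s_W(w))=i_V(f(w))+s_V(Q(w))$ for all $w\in W$, then the element of $A^2(Q)\otimes U$ represented by the quadratic map $f:W\to U$ is a cocycle, and its class corresponds to the extension. -/

import Mathlib

open scoped TensorProduct

universe u v

namespace QuadCoh

noncomputable section

/-- The field with two elements. -/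
abbrev F2 : Type := ZMod 2

section Quad

variable {W V U : Type*} [AddCommGroup W] [Module F2 W] [AddCommGroup V] [Module F2 V]
  [AddCommGroup U] [Module F2 U]

/-- A morphism of quadratic maps: a pair of linear maps making the square commute. -/
structure QuadHom {W₁ V₁ W₂ V₂ : Type*} [AddCommGroup W₁] [Module F2 W₁] [AddCommGroup V₁]
    [Module F2 V₁] [AddCommGroup W₂] [Module F2 W₂] [AddCommGroup V₂] [Module F2 V₂]
    (Q₁ : QuadraticMap F2 W₁ V₁) (Q₂ : QuadraticMap F2 W₂ V₂) where
  onW : W₁ →ₗ[F2] W₂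
  onV : V₁ →ₗ[F2] V₂
  comm : ∀ w, Q₂ (onW w) = onV (Q₁ w)

theorem F2.mul_self (a : F2) : a * a = a := by
  revert a; decide

variable (U) in
/-- The identity map of `U`, regarded as a quadratic map `U → U`. -/
def idQuad : QuadraticMap F2 U U where
  toFun u := u
  toFun_smul a x := by rw [F2.mul_self]
  exists_companion' := ⟨0, fun x y => by simp⟩

variable (U) in
/-- The quadratic map `End U → End U`, `A ↦ A² + A`. -/
def glQuad : QuadraticMap F2 (Module.End F2 U) (Module.End F2 U) where
  toFun A := A * A + A
  toFun_smul a A := by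
    rw [smul_add, F2.mul_self, smul_mul_smul_comm, F2.mul_self]
  exists_companion' := ⟨LinearMap.mul F2 (Module.End F2 U) +
      (LinearMap.mul F2 (Module.End F2 U)).flip, fun A B => by
    simp only [LinearMap.add_apply, LinearMap.mul_apply', LinearMap.flip_apply]
    noncomm_ring⟩

variable (U) in
/-- A `Q`-module structure on `U`: a morphism `ρ = (ρ_W, ρ_V) : Q → Q_{gl(U)}`. -/
abbrev Representation (Q : QuadraticMap F2 W V) : Type _ := QuadHom Q (glQuad U)

end Quad

section Polynomials

/-! With respect to a basis `b` of `W`, the ring `H^*(W; F₂)` is the polynomial ring on the dual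
basis. -/

variable {ι κ : Type*} {W V U : Type*} [AddCommGroup W] [Module F2 W] [AddCommGroup V] [Module F2 V]
  [AddCommGroup U] [Module F2 U]

variable (ι) in
/-- The Bockstein operator on `F₂[x_i]`: the derivation with `β(x_i) = x_i²`. -/
def bockstein : Derivation F2 (MvPolynomial ι F2) (MvPolynomial ι F2) :=
  MvPolynomial.mkDerivation F2 fun i => MvPolynomial.X i ^ 2

/-- The value at `w ∈ W` of a polynomial in the coordinates dual to the basis `b`. -/
def evalAt (b : Module.Basis ι F2 W) (w : W) : MvPolynomial ι F2 →ₐ[F2] F2 :=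
  MvPolynomial.aeval fun i => b.repr w i

/-- `p` is the component of the extension class of `Q` along the functional `φ`: the (unique)
homogeneous quadratic polynomial which represents the function `φ ∘ Q`. -/
def IsComponent (b : Module.Basis ι F2 W) (Q : QuadraticMap F2 W V) (φ : Module.Dual F2 V)
    (p : MvPolynomial ι F2) : Prop :=
  p.IsHomogeneous 2 ∧ ∀ w, evalAt b w p = φ (Q w)

/-- The ideal `I(Q)` generated by the components of the extension class of `Q`. -/
def classIdeal (b : Module.Basis ι F2 W) (Q : QuadraticMap F2 W V) : Ideal (MvPolynomial ι F2) :=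
  Ideal.span {p | ∃ φ : Module.Dual F2 V, IsComponent b Q φ p}

/-- `Q` is Bockstein closed: the ideal `I(Q)` is invariant under the Bockstein operator.  The choice
of the basis is irrelevant, see `isBocksteinClosed_iff`. -/
def IsBocksteinClosed (Q : QuadraticMap F2 W V) : Prop :=
  ∀ p ∈ classIdeal (Module.Basis.ofVectorSpace F2 W) Q,
    bockstein _ p ∈ classIdeal (Module.Basis.ofVectorSpace F2 W) Q

/-- The linear change of variables between two systems of coordinates on `W`. -/
def changeVar [Fintype κ] (b : Module.Basis ι F2 W) (c : Module.Basis κ F2 W) :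
    MvPolynomial ι F2 →ₐ[F2] MvPolynomial κ F2 :=
  MvPolynomial.aeval fun i => ∑ j, MvPolynomial.C (b.repr (c j) i) * MvPolynomial.X j

theorem repr_eq_sum [Fintype κ] (b : Module.Basis ι F2 W) (c : Module.Basis κ F2 W) (w : W)
    (i : ι) : ∑ j, b.repr (c j) i * c.repr w j = b.repr w i := by
  have h := congrArg (fun z => b.repr z i) (c.sum_repr w)
  simp only [map_sum, map_smul, Finsupp.finsetSum_apply, Finsupp.smul_apply, smul_eq_mul] at h
  rw [← h]
  exact Finset.sum_congr rfl fun j _ => mul_comm _ _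

theorem evalAt_changeVar [Fintype κ] (b : Module.Basis ι F2 W) (c : Module.Basis κ F2 W) (w : W)
    (p : MvPolynomial ι F2) : evalAt c w (changeVar b c p) = evalAt b w p := by
  have : (evalAt c w).comp (changeVar b c) = evalAt b w := by
    apply MvPolynomial.algHom_ext
    intro i
    simp only [AlgHom.comp_apply, changeVar, MvPolynomial.aeval_X, map_sum, map_mul, evalAt,
      MvPolynomial.aeval_C]
    exact repr_eq_sum b c w i
  exact DFunLike.congr_fun this p

theorem changeVar_changeVar [Fintype ι] [Fintype κ] (b : Module.Basis ι F2 W)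
    (c : Module.Basis κ F2 W) (p : MvPolynomial ι F2) :
    changeVar c b (changeVar b c p) = p := by
  have : (changeVar c b).comp (changeVar b c) = AlgHom.id F2 _ := by
    apply MvPolynomial.algHom_ext
    intro i
    have key := fun k => repr_eq_sum b c (b k) i
    simp only [AlgHom.comp_apply, changeVar, MvPolynomial.aeval_X, map_sum, map_mul,
      MvPolynomial.algHom_C, MvPolynomial.algebraMap_eq, Finset.mul_sum, AlgHom.id_apply]
    rw [Finset.sum_comm]
    simp only [← mul_assoc, ← Finset.sum_mul, ← map_mul, ← map_sum, key]
    classical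
    simp [Finsupp.single_apply]
  exact DFunLike.congr_fun this p

theorem F2poly_add_self (p : MvPolynomial ι F2) : p + p = 0 := CharTwo.add_self_eq_zero p

theorem bockstein_X (i : ι) : bockstein ι (MvPolynomial.X i) = MvPolynomial.X i ^ 2 :=
  MvPolynomial.mkDerivation_X _ _ _

theorem bockstein_changeVar [Fintype κ] (b : Module.Basis ι F2 W) (c : Module.Basis κ F2 W)
    (p : MvPolynomial ι F2) :
    bockstein κ (changeVar b c p) = changeVar b c (bockstein ι p) := by
  induction p using MvPolynomial.induction_on with
  | C a =>
    rw [changeVar, MvPolynomial.algHom_C, MvPolynomial.algebraMap_eq]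
    simp [bockstein]
  | add p q hp hq => simp only [map_add, hp, hq]
  | mul_X p i hp =>
    simp only [map_mul, Derivation.leibniz, hp, smul_eq_mul, map_add, bockstein_X, map_pow]
    congr 2
    simp only [changeVar, MvPolynomial.aeval_X, map_sum, Derivation.leibniz, smul_eq_mul,
      bockstein_X, sum_pow_char 2, mul_pow]
    refine Finset.sum_congr rfl fun j _ => ?_
    rw [← map_pow, pow_two (b.repr (c j) i), F2.mul_self]
    simp [bockstein]

theorem changeVar_mem [Fintype κ] (b : Module.Basis ι F2 W) (c : Module.Basis κ F2 W)
    (Q : QuadraticMap F2 W V) (p : MvPolynomial ι F2) (hp : p ∈ classIdeal b Q) :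
    changeVar b c p ∈ classIdeal c Q := by
  have h : classIdeal b Q ≤ (classIdeal c Q).comap (changeVar b c) := by
    rw [classIdeal, Ideal.span_le]
    rintro p ⟨φ, hp, hφ⟩
    refine Ideal.subset_span ⟨φ, ?_, fun w => by rw [evalAt_changeVar, hφ]⟩
    have := hp.aeval (fun i => ∑ j, MvPolynomial.C (b.repr (c j) i) * MvPolynomial.X j) (n := 1)
      (fun i => MvPolynomial.IsHomogeneous.sum _ _ _ fun j _ => by
        simpa using (MvPolynomial.isHomogeneous_C κ (b.repr (c j) i)).mul
          (MvPolynomial.isHomogeneous_X F2 j))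
    simpa [changeVar] using this
  exact h hp

theorem isBocksteinClosed_iff [Finite ι] (b : Module.Basis ι F2 W) (Q : QuadraticMap F2 W V) :
    IsBocksteinClosed Q ↔ ∀ p ∈ classIdeal b Q, bockstein ι p ∈ classIdeal b Q := by
  have := Fintype.ofFinite ι
  have : Module.Finite F2 W := Module.Finite.of_basis b
  have : Finite (Module.Basis.ofVectorSpaceIndex F2 W) :=
    Module.Finite.finite_basis (Module.Basis.ofVectorSpace F2 W)
  have := Fintype.ofFinite (Module.Basis.ofVectorSpaceIndex F2 W)
  let c := Module.Basis.ofVectorSpace F2 W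
  constructor
  · intro h p hp
    have := changeVar_mem c b Q _ (h _ (changeVar_mem b c Q p hp))
    rwa [← bockstein_changeVar, changeVar_changeVar] at this
  · intro h p hp
    have := changeVar_mem b c Q _ (h _ (changeVar_mem c b Q p hp))
    rwa [← bockstein_changeVar, changeVar_changeVar] at this

theorem bockstein_bockstein (p : MvPolynomial ι F2) : bockstein ι (bockstein ι p) = 0 := by
  induction p using MvPolynomial.induction_on with
  | C a => simp [bockstein]
  | add p q hp hq => simp only [map_add, hp, hq, add_zero]
  | mul_X p i hp =>
    simp only [Derivation.leibniz, hp, smul_eq_mul, map_add, bockstein_X, pow_two]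
    linear_combination (MvPolynomial.X i ^ 2 * bockstein ι p +
      p * MvPolynomial.X i ^ 3) * (CharTwo.two_eq_zero (R := MvPolynomial ι F2))

theorem bockstein_isHomogeneous {p : MvPolynomial ι F2} {n : ℕ} (hp : p.IsHomogeneous n) :
    (bockstein ι p).IsHomogeneous (n + 1) := by
  classical
  rw [p.as_sum, map_sum]
  refine MvPolynomial.IsHomogeneous.sum _ _ _ fun s hs => ?_
  have hs : s.degree = n := by
    by_contra h
    exact MvPolynomial.mem_support_iff.1 hs (hp.coeff_eq_zero h)
  rw [bockstein, MvPolynomial.mkDerivation_monomial]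
  refine (MvPolynomial.homogeneousSubmodule ι F2 (n + 1)).smul_mem _
    (sum_mem fun i hi => ?_)
  have hle : Finsupp.single i 1 ≤ s :=
    Finsupp.single_le_iff.2 (Nat.one_le_iff_ne_zero.2 (Finsupp.mem_support_iff.1 hi))
  have hd : (s - Finsupp.single i 1).degree + 1 = n := by
    rw [← hs]
    conv_rhs => rw [← tsub_add_cancel_of_le hle]
    simp [map_add]
  have h := (MvPolynomial.isHomogeneous_monomial (s i : F2) (d := s - Finsupp.single i 1) rfl).mul
    ((MvPolynomial.isHomogeneous_X F2 i).pow 2)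
  change MvPolynomial.IsHomogeneous (_ * _) _
  convert h using 1
  omega

end Polynomials

section Cohomology

variable {ι : Type*} {W V U : Type*} [AddCommGroup W] [Module F2 W] [AddCommGroup V] [Module F2 V]
  [AddCommGroup U] [Module F2 U]

/-- The algebra `A^*(Q) = F₂[x_i] / (q_1, …, q_n)`. -/
abbrev AlgA (b : Module.Basis ι F2 W) (Q : QuadraticMap F2 W V) : Type _ :=
  MvPolynomial ι F2 ⧸ classIdeal b Q

/-- The quotient map `F₂[x_i] → A^*(Q)`. -/
abbrev toA (b : Module.Basis ι F2 W) (Q : QuadraticMap F2 W V) :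
    MvPolynomial ι F2 →ₐ[F2] AlgA b Q :=
  Ideal.Quotient.mkₐ F2 (classIdeal b Q)

/-- The homogeneous part `A^p(Q)`. -/
def gradeA (b : Module.Basis ι F2 W) (Q : QuadraticMap F2 W V) (p : ℕ) : Submodule F2 (AlgA b Q) :=
  (MvPolynomial.homogeneousSubmodule ι F2 p).map (toA b Q).toLinearMap

/-- The cochains `C^p(Q, U) = A^p(Q) ⊗ U`, as a subspace of `A^*(Q) ⊗ U`. -/
def cochains (b : Module.Basis ι F2 W) (Q : QuadraticMap F2 W V) (U : Type*) [AddCommGroup U]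
    [Module F2 U] (p : ℕ) : Submodule F2 (AlgA b Q ⊗[F2] U) :=
  LinearMap.range ((gradeA b Q p).subtype.rTensor U)

instance tensorAddCommGroup (b : Module.Basis ι F2 W) (Q : QuadraticMap F2 W V) :
    AddCommGroup (AlgA b Q ⊗[F2] U) := TensorProduct.addCommGroup

theorem tmul_mem_cochains (b : Module.Basis ι F2 W) {Q : QuadraticMap F2 W V}
    {p : MvPolynomial ι F2} {n : ℕ}
    (hp : p.IsHomogeneous n) (x : U) : toA b Q p ⊗ₜ[F2] x ∈ cochains b Q U n :=
  ⟨(⟨toA b Q p, p, hp, rfl⟩ : gradeA b Q n) ⊗ₜ x, by simp⟩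

variable [Fintype ι] {Q : QuadraticMap F2 W V}

/-- The Bockstein operator induced on `A^*(Q)`, for `Q` Bockstein closed. -/
def bocksteinA (b : Module.Basis ι F2 W) (hQ : IsBocksteinClosed Q) :
    AlgA b Q →ₗ[F2] AlgA b Q :=
  let e := Submodule.Quotient.restrictScalarsEquiv F2 (classIdeal b Q)
  e.toLinearMap ∘ₗ
    ((classIdeal b Q).restrictScalars F2).mapQ ((classIdeal b Q).restrictScalars F2)
      (bockstein ι).toLinearMap
      (fun p hp => (isBocksteinClosed_iff b Q).1 hQ p hp) ∘ₗ e.symm.toLinearMap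

theorem bocksteinA_toA (b : Module.Basis ι F2 W) (hQ : IsBocksteinClosed Q)
    (p : MvPolynomial ι F2) : bocksteinA b hQ (toA b Q p) = toA b Q (bockstein ι p) := rfl

/-- The action on `A^*(Q) ⊗ U` of the class `R = ∑ x_i ρ_W(b_i)` of `ρ_W` in
`H^1(W, End U)`. -/
def mulR (b : Module.Basis ι F2 W) (ρ : Representation U Q) :
    AlgA b Q ⊗[F2] U →ₗ[F2] AlgA b Q ⊗[F2] U :=
  ∑ i, TensorProduct.map (LinearMap.mulLeft F2 (toA b Q (MvPolynomial.X i))) (ρ.onW (b i))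

/-- The differential `δ(f) = β(f) + R f`. -/
def delta (b : Module.Basis ι F2 W) (hQ : IsBocksteinClosed Q) (ρ : Representation U Q) :
    AlgA b Q ⊗[F2] U →ₗ[F2] AlgA b Q ⊗[F2] U :=
  (bocksteinA b hQ).rTensor U + mulR b ρ

theorem delta_tmul (b : Module.Basis ι F2 W) (hQ : IsBocksteinClosed Q) (ρ : Representation U Q)
    (p : MvPolynomial ι F2) (x : U) :
    delta b hQ ρ (toA b Q p ⊗ₜ x) = toA b Q (bockstein ι p) ⊗ₜ x +
      ∑ i, toA b Q (MvPolynomial.X i * p) ⊗ₜ[F2] (ρ.onW (b i) x) := by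
  rw [← bocksteinA_toA b hQ]
  simp [delta, mulR, LinearMap.sum_apply]

/-- The differential raises the degree by one. -/
theorem delta_mem (b : Module.Basis ι F2 W) (hQ : IsBocksteinClosed Q) (ρ : Representation U Q)
    (n : ℕ) (c) (hc : c ∈ cochains b Q U n) : delta b hQ ρ c ∈ cochains b Q U (n + 1) := by
  obtain ⟨t, rfl⟩ := hc
  induction t using TensorProduct.induction_on with
  | zero => simp
  | add s t hs ht => simpa only [map_add] using add_mem hs ht
  | tmul a x =>
    obtain ⟨_, p, hp, rfl⟩ := a
    change delta b hQ ρ (toA b Q p ⊗ₜ x) ∈ _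
    rw [delta_tmul]
    refine add_mem (tmul_mem_cochains b (bockstein_isHomogeneous hp) x) (sum_mem fun i _ => ?_)
    refine tmul_mem_cochains b ?_ _
    rw [add_comm]
    exact (MvPolynomial.isHomogeneous_X F2 i).mul hp

/-- The relation `β(R) + R² = 0` in `A^*(Q) ⊗ End U`. -/
theorem maurerCartan (b : Module.Basis ι F2 W) (ρ : Representation U Q) :
    (∑ i, toA b Q (MvPolynomial.X i ^ 2) ⊗ₜ[F2] ρ.onW (b i)) +
      ∑ i, ∑ j, toA b Q (MvPolynomial.X j * MvPolynomial.X i) ⊗ₜ[F2]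
        (ρ.onW (b j) * ρ.onW (b i)) = 0 := by
  classical
  let m := Module.Basis.ofVectorSpace F2 (Module.End F2 U)
  apply (TensorProduct.equivFinsuppOfBasisRight (M := AlgA b Q) m).injective
  ext k
  simp only [map_add, map_sum, Finsupp.add_apply, Finsupp.finsetSum_apply,
    TensorProduct.equivFinsuppOfBasisRight_apply_tmul_apply, map_zero, Finsupp.zero_apply]
  simp only [← map_smul, ← map_sum, ← map_add]
  rw [Ideal.Quotient.mkₐ_eq_mk, Ideal.Quotient.eq_zero_iff_mem]
  refine Ideal.subset_span ⟨m.coord k ∘ₗ ρ.onV, ?_, fun w => ?_⟩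
  · have h : ∀ (a : F2) (i j : ι),
        (a • (MvPolynomial.X j * MvPolynomial.X i) : MvPolynomial ι F2).IsHomogeneous 2 :=
      fun a i j => (MvPolynomial.homogeneousSubmodule ι F2 2).smul_mem a
        ((MvPolynomial.isHomogeneous_X F2 j).mul (MvPolynomial.isHomogeneous_X F2 i))
    refine .add (.sum _ _ _ fun i _ => ?_) (.sum _ _ _ fun i _ => .sum _ _ _ fun j _ => h _ _ _)
    rw [pow_two]; exact h _ _ _
  · rw [LinearMap.comp_apply, ← ρ.comm]
    have hw : ρ.onW w = ∑ i, b.repr w i • ρ.onW (b i) := by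
      conv_lhs => rw [← b.sum_repr w]
      simp only [map_sum, map_smul]
    change _ = m.coord k (ρ.onW w * ρ.onW w + ρ.onW w)
    rw [hw]
    simp only [evalAt, map_add, map_sum, map_smul, map_mul, MvPolynomial.aeval_X,
      Finset.sum_mul, Finset.mul_sum, Module.Basis.coord_apply, smul_mul_smul_comm, smul_eq_mul,
      pow_two, F2.mul_self]
    rw [add_comm]
    congr 1
    · refine Finset.sum_congr rfl fun i _ => Finset.sum_congr rfl fun j _ => ?_
      ring
    · refine Finset.sum_congr rfl fun i _ => ?_
      ring

theorem delta_delta (b : Module.Basis ι F2 W) (hQ : IsBocksteinClosed Q) (ρ : Representation U Q)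
    (c) : delta b hQ ρ (delta b hQ ρ c) = 0 := by
  induction c using TensorProduct.induction_on with
  | zero => simp
  | add s t hs ht => simp only [map_add, hs, ht, add_zero]
  | tmul a x =>
    obtain ⟨p, rfl⟩ := Ideal.Quotient.mkₐ_surjective F2 _ a
    have key := congrArg (TensorProduct.map (LinearMap.mulLeft F2 (toA b Q p))
      (LinearMap.applyₗ x)) (maurerCartan b ρ)
    change delta b hQ ρ (delta b hQ ρ (toA b Q p ⊗ₜ x)) = 0
    rw [delta_tmul, map_add, delta_tmul, bockstein_bockstein, map_sum]
    simp only [delta_tmul, bockstein_X, Derivation.leibniz, map_zero, TensorProduct.zero_tmul,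
      zero_add, map_add, TensorProduct.add_tmul, smul_eq_mul, Finset.sum_add_distrib]
    simp only [map_add, map_sum, TensorProduct.map_tmul, LinearMap.mulLeft_apply, map_zero,
      LinearMap.applyₗ_apply_apply, Module.End.mul_apply] at key
    simp only [← map_mul] at key
    have h2 : ∀ z : AlgA b Q ⊗[F2] U, z + z = 0 := fun z => by
      have h := two_smul F2 z
      rw [show (2 : F2) = 0 from rfl, zero_smul] at h
      exact h.symm
    rw [add_assoc, ← add_assoc, h2, zero_add]
    have e : ∀ i j : ι, MvPolynomial.X j * (MvPolynomial.X i * p) =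
      p * (MvPolynomial.X j * MvPolynomial.X i) := fun i j => by ring
    simp only [e]
    exact key

/-- The `p`-cocycles. -/
def cocycles (b : Module.Basis ι F2 W) (hQ : IsBocksteinClosed Q) (ρ : Representation U Q)
    (p : ℕ) : Submodule F2 (AlgA b Q ⊗[F2] U) :=
  cochains b Q U p ⊓ LinearMap.ker (delta b hQ ρ)

/-- The `p`-coboundaries. -/
def coboundaries (b : Module.Basis ι F2 W) (hQ : IsBocksteinClosed Q) (ρ : Representation U Q) :
    ℕ → Submodule F2 (AlgA b Q ⊗[F2] U)
  | 0 => ⊥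
  | p + 1 => (cochains b Q U p).map (delta b hQ ρ)

theorem coboundaries_le_cocycles (b : Module.Basis ι F2 W) (hQ : IsBocksteinClosed Q)
    (ρ : Representation U Q) (p : ℕ) : coboundaries b hQ ρ p ≤ cocycles b hQ ρ p := by
  cases p with
  | zero => exact bot_le
  | succ p =>
    rintro _ ⟨c, hc, rfl⟩
    exact ⟨delta_mem b hQ ρ p c hc, delta_delta b hQ ρ c⟩

/-- The cohomology `H^p(Q, U)`: cocycles modulo coboundaries. -/
abbrev Cohomology (b : Module.Basis ι F2 W) (hQ : IsBocksteinClosed Q) (ρ : Representation U Q)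
    (p : ℕ) : Type _ :=
  cocycles b hQ ρ p ⧸ (coboundaries b hQ ρ p).submoduleOf (cocycles b hQ ρ p)

/-- The cohomology class of a cocycle. -/
def cohClass (b : Module.Basis ι F2 W) (hQ : IsBocksteinClosed Q) (ρ : Representation U Q)
    {p : ℕ} (c : AlgA b Q ⊗[F2] U) (hc : c ∈ cocycles b hQ ρ p) : Cohomology b hQ ρ p :=
  Submodule.Quotient.mk ⟨c, hc⟩

/-- The cochain `c ∈ C^p(Q, U)` represents the function `f : W → U`: it is the class of an element
of `F₂[x_i]_p ⊗ U` whose value at each `w` is `f w`. -/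
def Represents (b : Module.Basis ι F2 W) (p : ℕ) (c : AlgA b Q ⊗[F2] U) (f : W → U) : Prop :=
  ∃ t ∈ LinearMap.range ((MvPolynomial.homogeneousSubmodule ι F2 p).subtype.rTensor U),
    (∀ w, TensorProduct.lid F2 U ((evalAt b w).toLinearMap.rTensor U t) = f w) ∧
      (toA b Q).toLinearMap.rTensor U t = c

end Cohomology

section Extensions

variable {W V U : Type u} [AddCommGroup W] [Module F2 W] [AddCommGroup V] [Module F2 V]
  [AddCommGroup U] [Module F2 U]

/-- An extension `0 → U → Q̃ → Q → 0` of the quadratic map `Q` with abelian kernel `U`: `i` is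
injective, `π` is surjective and the image of `i` is the kernel of `π`, where `U` stands for the
quadratic map `id_U`. -/
structure AbExt (Q : QuadraticMap F2 W V) (U : Type u) [AddCommGroup U] [Module F2 U] where
  domW : Type u
  codV : Type u
  [grpW : AddCommGroup domW]
  [modW : Module F2 domW]
  [grpV : AddCommGroup codV]
  [modV : Module F2 codV]
  quad : QuadraticMap F2 domW codV
  i : QuadHom (idQuad U) quad
  π : QuadHom quad Q
  injW : Function.Injective i.onW
  injV : Function.Injective i.onV
  surjW : Function.Surjective π.onW
  surjV : Function.Surjective π.onV
  exactW : LinearMap.range i.onW = LinearMap.ker π.onW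
  exactV : LinearMap.range i.onV = LinearMap.ker π.onV

attribute [instance] AbExt.grpW AbExt.modW AbExt.grpV AbExt.modV

variable {Q : QuadraticMap F2 W V}

/-- The action of `W` on `U` induced by the extension is `ρ_W`:
`i_V (ρ_W(w) u) = B̃(i_W u, w̃)` whenever `w̃` lifts `w`. -/
def AbExt.HasAction (E : AbExt Q U) (ρ : Representation U Q) : Prop :=
  ∀ (u : U) (x : E.domW),
    E.i.onV (ρ.onW (E.π.onW x) u) = QuadraticMap.polar E.quad (E.i.onW u) x

/-- Equivalence of extensions: there is a morphism of the middle terms which is the identity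
on `U` and on `Q`. -/
def AbExt.Equivalent (E₁ E₂ : AbExt Q U) : Prop :=
  ∃ φ : QuadHom E₁.quad E₂.quad,
    (∀ u, φ.onW (E₁.i.onW u) = E₂.i.onW u) ∧ (∀ u, φ.onV (E₁.i.onV u) = E₂.i.onV u) ∧
    (∀ x, E₂.π.onW (φ.onW x) = E₁.π.onW x) ∧ (∀ y, E₂.π.onV (φ.onV y) = E₁.π.onV y)

theorem AbExt.Equivalent.refl (E : AbExt Q U) : E.Equivalent E :=
  ⟨⟨LinearMap.id, LinearMap.id, fun _ => rfl⟩, fun _ => rfl, fun _ => rfl, fun _ => rfl,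
    fun _ => rfl⟩

theorem AbExt.Equivalent.trans {E₁ E₂ E₃ : AbExt Q U} (h : E₁.Equivalent E₂)
    (h' : E₂.Equivalent E₃) : E₁.Equivalent E₃ := by
  obtain ⟨φ, h1, h2, h3, h4⟩ := h
  obtain ⟨ψ, k1, k2, k3, k4⟩ := h'
  refine ⟨⟨ψ.onW ∘ₗ φ.onW, ψ.onV ∘ₗ φ.onV, fun w => ?_⟩, ?_, ?_, ?_, ?_⟩
  · simp [ψ.comm, φ.comm]
  all_goals intro x; simp [*]

theorem bijective_of_ses {M N A B : Type*} [AddCommGroup M] [Module F2 M] [AddCommGroup N]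
    [Module F2 N] [AddCommGroup A] [Module F2 A] [AddCommGroup B] [Module F2 B]
    {i : A →ₗ[F2] M} {π : M →ₗ[F2] B} {j : A →ₗ[F2] N} {σ : N →ₗ[F2] B} (φ : M →ₗ[F2] N)
    (hj : Function.Injective j) (hπ : Function.Surjective π)
    (hi : LinearMap.range i = LinearMap.ker π) (hjσ : LinearMap.range j = LinearMap.ker σ)
    (h1 : ∀ a, φ (i a) = j a) (h2 : ∀ m, σ (φ m) = π m) : Function.Bijective φ := by
  constructor
  · rw [injective_iff_map_eq_zero]
    intro m hm
    have : m ∈ LinearMap.range i := by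
      rw [hi, LinearMap.mem_ker, ← h2, hm, map_zero]
    obtain ⟨a, rfl⟩ := this
    rw [h1] at hm
    rw [hj (hm.trans (map_zero j).symm), map_zero]
  · intro n
    obtain ⟨m, hm⟩ := hπ (σ n)
    have : n - φ m ∈ LinearMap.range j := by
      rw [hjσ, LinearMap.mem_ker, map_sub, h2, hm, sub_self]
    obtain ⟨a, ha⟩ := this
    exact ⟨m + i a, by rw [map_add, h1, ha]; abel⟩

theorem AbExt.Equivalent.symm {E₁ E₂ : AbExt Q U} (h : E₁.Equivalent E₂) : E₂.Equivalent E₁ := by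
  obtain ⟨φ, h1, h2, h3, h4⟩ := h
  let eW := LinearEquiv.ofBijective φ.onW
    (bijective_of_ses φ.onW E₂.injW E₁.surjW E₁.exactW E₂.exactW h1 h3)
  let eV := LinearEquiv.ofBijective φ.onV
    (bijective_of_ses φ.onV E₂.injV E₁.surjV E₁.exactV E₂.exactV h2 h4)
  have hW : ∀ x, φ.onW (eW.symm x) = x := fun x => eW.apply_symm_apply x
  have hV : ∀ x, φ.onV (eV.symm x) = x := fun x => eV.apply_symm_apply x
  refine ⟨⟨eW.symm.toLinearMap, eV.symm.toLinearMap, fun w => ?_⟩, ?_, ?_, ?_, ?_⟩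
  · apply eV.injective
    change φ.onV _ = φ.onV (eV.symm _)
    rw [hV, ← φ.comm]
    exact congrArg _ (hW w)
  · intro x; apply eW.injective; exact (hW _).trans (h1 x).symm
  · intro x; apply eV.injective; exact (hV _).trans (h2 x).symm
  · intro x; exact (h3 _).symm.trans (congrArg _ (hW x))
  · intro x; exact (h4 _).symm.trans (congrArg _ (hV x))

/-- An extension with abelian kernel `U` of Bockstein closed quadratic maps which induces the given
action on the `Q`-module `U`. -/
structure BExt (ρ : Representation U Q) where
  ext : AbExt Q U
  hasAction : ext.HasAction ρ
  closed : IsBocksteinClosed ext.quad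

/-- Equivalence of extensions. -/
instance extSetoid (ρ : Representation U Q) : Setoid (BExt ρ) where
  r E₁ E₂ := E₁.ext.Equivalent E₂.ext
  iseqv := ⟨fun E => .refl E.ext, fun h => h.symm, fun h h' => h.trans h'⟩

/-- `Ext(Q, U)`: the equivalence classes of extensions. -/
def Ext (ρ : Representation U Q) : Type (u + 1) := Quotient (extSetoid ρ)

/-- The class of an extension in `Ext(Q, U)`. -/
def BExt.cls {ρ : Representation U Q} (E : BExt ρ) : Ext ρ := Quotient.mk (extSetoid ρ) E

/-- `f : W → U` is a factor set of the extension: there are linear sections `s_W` of `π_W` and `s_V`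
of `π_V` with `Q̃(s_W w) = i_V (f w) + s_V (Q w)`. -/
def AbExt.IsFactorSet (E : AbExt Q U) (f : W → U) : Prop :=
  ∃ (sW : W →ₗ[F2] E.domW) (sV : V →ₗ[F2] E.codV),
    (∀ w, E.π.onW (sW w) = w) ∧ (∀ v, E.π.onV (sV v) = v) ∧
      ∀ w, E.quad (sW w) = E.i.onV (f w) + sV (Q w)

end Extensions

section BaerLinear

/-! The Baer sum of two extensions `A → M₁ → B` and `A → M₂ → B` of vector spaces. -/

variable {A B M₁ M₂ : Type u} [AddCommGroup A] [Module F2 A] [AddCommGroup B] [Module F2 B]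
  [AddCommGroup M₁] [Module F2 M₁] [AddCommGroup M₂] [Module F2 M₂]

/-- The fibre product of `M₁` and `M₂` over `B`. -/
def fibre (π₁ : M₁ →ₗ[F2] B) (π₂ : M₂ →ₗ[F2] B) : Submodule F2 (M₁ × M₂) :=
  LinearMap.eqLocus (π₁ ∘ₗ LinearMap.fst F2 M₁ M₂) (π₂ ∘ₗ LinearMap.snd F2 M₁ M₂)

/-- The antidiagonal copy of `A`, as a subspace of the fibre product. -/
def antidiag (i₁ : A →ₗ[F2] M₁) (i₂ : A →ₗ[F2] M₂) (π₁ : M₁ →ₗ[F2] B) (π₂ : M₂ →ₗ[F2] B) :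
    Submodule F2 (fibre π₁ π₂) :=
  (LinearMap.range (i₁.prod (-i₂))).submoduleOf (fibre π₁ π₂)

/-- The fibre product modulo the antidiagonal. -/
abbrev Baer (i₁ : A →ₗ[F2] M₁) (i₂ : A →ₗ[F2] M₂) (π₁ : M₁ →ₗ[F2] B) (π₂ : M₂ →ₗ[F2] B) : Type u :=
  fibre π₁ π₂ ⧸ antidiag i₁ i₂ π₁ π₂

variable {i₁ : A →ₗ[F2] M₁} {i₂ : A →ₗ[F2] M₂} {π₁ : M₁ →ₗ[F2] B} {π₂ : M₂ →ₗ[F2] B}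

theorem mem_antidiag {x : fibre π₁ π₂} :
    x ∈ antidiag i₁ i₂ π₁ π₂ ↔ ∃ a, i₁ a = x.1.1 ∧ -i₂ a = x.1.2 := by
  simp [antidiag, Submodule.submoduleOf, Prod.ext_iff]

theorem map_range {A B M : Type*} [AddCommGroup A] [Module F2 A] [AddCommGroup B] [Module F2 B]
    [AddCommGroup M] [Module F2 M] {i : A →ₗ[F2] M} {π : M →ₗ[F2] B}
    (h : LinearMap.range i = LinearMap.ker π) (a : A) : π (i a) = 0 := by
  rw [← LinearMap.mem_ker, ← h]
  exact ⟨a, rfl⟩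

variable (h₁ : LinearMap.range i₁ = LinearMap.ker π₁)

/-- The inclusion `a ↦ [(i₁ a, 0)]` of the kernel. -/
def baerIncl : A →ₗ[F2] Baer i₁ i₂ π₁ π₂ :=
  (antidiag i₁ i₂ π₁ π₂).mkQ ∘ₗ ((LinearMap.inl F2 M₁ M₂ ∘ₗ i₁).codRestrict (fibre π₁ π₂)
    (fun a => by simp [fibre, map_range h₁]))

/-- The projection `[(x₁, x₂)] ↦ π₁ x₁ = π₂ x₂`. -/
def baerProj : Baer i₁ i₂ π₁ π₂ →ₗ[F2] B :=
  (antidiag i₁ i₂ π₁ π₂).liftQ (π₁ ∘ₗ LinearMap.fst F2 M₁ M₂ ∘ₗ (fibre π₁ π₂).subtype)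
    (fun x hx => by
      obtain ⟨a, ha, -⟩ := mem_antidiag.1 hx
      simp [← ha, map_range h₁])

theorem baerIncl_injective (j₁ : Function.Injective i₁) (j₂ : Function.Injective i₂) :
    Function.Injective (baerIncl (i₂ := i₂) (π₂ := π₂) h₁) := by
  rw [injective_iff_map_eq_zero]
  intro a ha
  obtain ⟨c, hc, hc'⟩ := mem_antidiag.1 ((Submodule.Quotient.mk_eq_zero _).1 ha)
  have h0 : c = 0 := j₂ (by
    have h' : -i₂ c = 0 := hc'
    rw [neg_eq_zero] at h'
    rw [h', map_zero])
  have h1 : i₁ c = i₁ a := hc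
  rw [← j₁ h1, h0]

theorem baerProj_surjective (s₁ : Function.Surjective π₁) (s₂ : Function.Surjective π₂) :
    Function.Surjective (baerProj (i₂ := i₂) (π₂ := π₂) h₁) := by
  intro y
  obtain ⟨x₁, hx₁⟩ := s₁ y
  obtain ⟨x₂, hx₂⟩ := s₂ y
  exact ⟨Submodule.Quotient.mk ⟨(x₁, x₂), hx₁.trans hx₂.symm⟩, hx₁⟩

theorem baer_exact (h₂ : LinearMap.range i₂ = LinearMap.ker π₂) :
    LinearMap.range (baerIncl (i₂ := i₂) (π₂ := π₂) h₁) = LinearMap.ker (baerProj h₁) := by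
  ext x
  constructor
  · rintro ⟨a, rfl⟩
    exact map_range h₁ a
  · intro hx
    obtain ⟨⟨⟨x₁, x₂⟩, h⟩, rfl⟩ := Submodule.Quotient.mk_surjective _ x
    have hx₁ : π₁ x₁ = 0 := hx
    have hx₂ : π₂ x₂ = 0 := h.symm.trans hx₁
    obtain ⟨a, rfl⟩ : x₁ ∈ LinearMap.range i₁ := by rw [h₁]; exact hx₁
    obtain ⟨c, rfl⟩ : x₂ ∈ LinearMap.range i₂ := by rw [h₂]; exact hx₂
    refine ⟨a + c, (Submodule.Quotient.eq _).2 (mem_antidiag.2 ⟨c, ?_, ?_⟩)⟩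
    · change i₁ c = i₁ (a + c) - i₁ a
      rw [map_add]; abel
    · change -i₂ c = 0 - i₂ c
      abel

end BaerLinear

section BaerQuad

variable {W V U : Type u} [AddCommGroup W] [Module F2 W] [AddCommGroup V] [Module F2 V]
  [AddCommGroup U] [Module F2 U] {Q : QuadraticMap F2 W V}

/-- The fibre product `Q̃₁ ×_Q Q̃₂`. -/
def fibreQuad (E₁ E₂ : AbExt Q U) :
    QuadraticMap F2 (fibre E₁.π.onW E₂.π.onW) (fibre E₁.π.onV E₂.π.onV) :=
  QuadraticMap.ofPolar
    (fun x => ⟨(E₁.quad x.1.1, E₂.quad x.1.2),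
      ((E₁.π.comm _).symm.trans (congrArg Q x.2)).trans (E₂.π.comm _)⟩)
    (fun a _ => Subtype.ext (Prod.ext (E₁.quad.map_smul a _) (E₂.quad.map_smul a _)))
    (fun _ _ _ => Subtype.ext (Prod.ext (QuadraticMap.polar_add_left E₁.quad _ _ _)
      (QuadraticMap.polar_add_left E₂.quad _ _ _)))
    (fun a _ _ => Subtype.ext (Prod.ext (QuadraticMap.polar_smul_left E₁.quad a _ _)
      (QuadraticMap.polar_smul_left E₂.quad a _ _)))

theorem quad_add (E : AbExt Q U) {ρ : Representation U Q} (h : E.HasAction ρ) (u : U) (x : E.domW) :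
    E.quad (E.i.onW u + x) = E.i.onV (u + ρ.onW (E.π.onW x) u) + E.quad x := by
  have h1 := h u x
  have h2 : E.quad (E.i.onW u) = E.i.onV u := E.i.comm u
  rw [QuadraticMap.polar, h2] at h1
  rw [map_add E.i.onV, h1]
  abel

theorem fibreQuad_congr (E₁ E₂ : AbExt Q U) {ρ : Representation U Q} (h₁ : E₁.HasAction ρ)
    (h₂ : E₂.HasAction ρ) (x y : fibre E₁.π.onW E₂.π.onW)
    (h : x - y ∈ antidiag E₁.i.onW E₂.i.onW E₁.π.onW E₂.π.onW) :
    fibreQuad E₁ E₂ x - fibreQuad E₁ E₂ y ∈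
      antidiag E₁.i.onV E₂.i.onV E₁.π.onV E₂.π.onV := by
  obtain ⟨a, ha₁, ha₂⟩ := mem_antidiag.1 h
  have e₁ : x.1.1 = E₁.i.onW a + y.1.1 := by rw [ha₁]; simp
  have e₂ : x.1.2 = E₂.i.onW (-a) + y.1.2 := by rw [map_neg, ha₂]; simp
  refine mem_antidiag.2 ⟨a + ρ.onW (E₁.π.onW y.1.1) a, ?_, ?_⟩
  · change _ = E₁.quad x.1.1 - E₁.quad y.1.1
    rw [e₁, quad_add E₁ h₁]
    abel
  · change _ = E₂.quad x.1.2 - E₂.quad y.1.2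
    rw [e₂, quad_add E₂ h₂, show E₁.π.onW y.1.1 = E₂.π.onW y.1.2 from y.2]
    simp only [map_add, map_neg]
    abel

/-- The quadratic map of the Baer sum: `[(x₁, x₂)] ↦ [(Q̃₁ x₁, Q̃₂ x₂)]`. -/
def baerQuad (E₁ E₂ : AbExt Q U) {ρ : Representation U Q} (h₁ : E₁.HasAction ρ)
    (h₂ : E₂.HasAction ρ) :
    QuadraticMap F2 (Baer E₁.i.onW E₂.i.onW E₁.π.onW E₂.π.onW)
      (Baer E₁.i.onV E₂.i.onV E₁.π.onV E₂.π.onV) :=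
  QuadraticMap.ofPolar
    (Quotient.map' (fibreQuad E₁ E₂) (fun x y h => (Submodule.quotientRel_def _).2
      (fibreQuad_congr E₁ E₂ h₁ h₂ x y ((Submodule.quotientRel_def _).1 h))))
    (fun a x => by
      obtain ⟨x, rfl⟩ := Submodule.Quotient.mk_surjective _ x
      exact congrArg Submodule.Quotient.mk ((fibreQuad E₁ E₂).map_smul a x))
    (fun x x' y => by
      obtain ⟨x, rfl⟩ := Submodule.Quotient.mk_surjective _ x
      obtain ⟨x', rfl⟩ := Submodule.Quotient.mk_surjective _ x'
      obtain ⟨y, rfl⟩ := Submodule.Quotient.mk_surjective _ y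
      exact congrArg Submodule.Quotient.mk
        (QuadraticMap.polar_add_left (fibreQuad E₁ E₂) x x' y))
    (fun a x y => by
      obtain ⟨x, rfl⟩ := Submodule.Quotient.mk_surjective _ x
      obtain ⟨y, rfl⟩ := Submodule.Quotient.mk_surjective _ y
      exact congrArg Submodule.Quotient.mk
        (QuadraticMap.polar_smul_left (fibreQuad E₁ E₂) a x y))

/-- The Baer sum of two extensions of `Q` which induce the same action on `U`: the fibre product
over `Q` modulo the antidiagonal copy of `U`. -/
def baerSum (E₁ E₂ : AbExt Q U) {ρ : Representation U Q} (h₁ : E₁.HasAction ρ)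
    (h₂ : E₂.HasAction ρ) : AbExt Q U where
  domW := Baer E₁.i.onW E₂.i.onW E₁.π.onW E₂.π.onW
  codV := Baer E₁.i.onV E₂.i.onV E₁.π.onV E₂.π.onV
  quad := baerQuad E₁ E₂ h₁ h₂
  i := ⟨baerIncl E₁.exactW, baerIncl E₁.exactV, fun u =>
    congrArg Submodule.Quotient.mk (Subtype.ext (Prod.ext (E₁.i.comm u) E₂.quad.map_zero))⟩
  π := ⟨baerProj E₁.exactW, baerProj E₁.exactV, fun x => by
    obtain ⟨x, rfl⟩ := Submodule.Quotient.mk_surjective _ x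
    exact E₁.π.comm x.1.1⟩
  injW := baerIncl_injective E₁.exactW E₁.injW E₂.injW
  injV := baerIncl_injective E₁.exactV E₁.injV E₂.injV
  surjW := baerProj_surjective E₁.exactW E₁.surjW E₂.surjW
  surjV := baerProj_surjective E₁.exactV E₁.surjV E₂.surjV
  exactW := baer_exact E₁.exactW E₂.exactW
  exactV := baer_exact E₁.exactV E₂.exactV

theorem baerSum_hasAction (E₁ E₂ : AbExt Q U) {ρ : Representation U Q} (h₁ : E₁.HasAction ρ)
    (h₂ : E₂.HasAction ρ) : (baerSum E₁ E₂ h₁ h₂).HasAction ρ := by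
  intro u x
  obtain ⟨x, rfl⟩ := Submodule.Quotient.mk_surjective
    (antidiag E₁.i.onW E₂.i.onW E₁.π.onW E₂.π.onW) x
  refine congrArg Submodule.Quotient.mk (Subtype.ext (Prod.ext (h₁ u x.1.1) ?_))
  change 0 = QuadraticMap.polar E₂.quad 0 x.1.2
  rw [QuadraticMap.polar_zero_left]

end BaerQuad

end

end QuadCoh

/-!
Choosing linear sections identifies an extension of `Q` by `U` with the quadratic map
`(u, w) ↦ (u + ρ_W(w) u + f(w), Q(w))` from `U × W` to `U × V`, where `f` is a factor set
(`AbExt.IsFactorSet.exists_equivalent`). Changing the sections changes `f` by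
`w ↦ λ(w) + ρ_W(w) λ(w)` and by `ν ∘ Q`, with `λ : W → U` and `ν : V → U` linear
(`extOf_equivalent_iff`). The first function is represented by the coboundary of the cochain of
degree one given by `λ`; the functions of the second kind are exactly those represented by `0` in
`A^2(Q) ⊗ U`, because a homogeneous quadratic polynomial over `F₂` is determined by its values and
the degree two part of `I(Q)` consists of the polynomials `q_φ` (`Represents.eq_zero_iff`). So two
extensions are equivalent if and only if their factor sets are cohomologous.

The essential point is that the extension with factor set `f` is Bockstein closed if and only if
`δ f = 0` (`isBocksteinClosed_extQuad_iff`). In coordinates `z_k` of `U`, its ideal is generated by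
`I(Q)` and the polynomials `p_k = z_k² + ∑ R_{kl} z_l + f_k`. A computation gives
`β(p_k) = ∑ R_{kl} p_l + ∑ (β(R) + R²)_{kj} z_j + (δ f)_k`, and `β(R) + R²` vanishes modulo `I(Q)`.
Hence `δ f = 0` in `A^3(Q) ⊗ U` makes the extension closed. The converse requires that `A^3(Q)`
embeds into the algebra of the extension (`mem_of_rename_mem_classIdeal`). The degree three part of
the ideal generated by the `p_k` in `A^*(Q)[z]` is spanned by the products of the `p_k` with one
variable, so it suffices to have an `A^*(Q)`-linear functional which kills these products and maps
`1` to `1`. It is `constTerm`, the constant term of the reduction by the relations `p_k = 0`.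

Factor sets therefore define a bijection between `Ext(Q, U)` and `H^2(Q, U)`, along which the group
structure is transported. A sum of factor sets is a factor set of the Baer sum
(`baerSum_isFactorSet`), so the Baer sum is Bockstein closed and the transported addition is the
Baer sum.
-/

namespace QuadCoh

noncomputable section

/-! ### Quadratic polynomials as functions -/

section QuadraticPolynomials

variable {ι W V : Type*} [AddCommGroup W] [Module F2 W] [AddCommGroup V] [Module F2 V]

theorem exists_eq_single_add_single {s : ι →₀ ℕ} (hs : s.degree = 2) :
    ∃ i j, s = Finsupp.single i 1 + Finsupp.single j 1 := by
  classical
  have hcard : s.toMultiset.card = 2 := by rw [Finsupp.card_toMultiset]; exact hs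
  obtain ⟨i, j, h⟩ := Multiset.card_eq_two.1 hcard
  refine ⟨i, j, (Finsupp.toMultiset_eq_iff.1 h).trans ?_⟩
  rw [Multiset.insert_eq_cons, ← Multiset.singleton_add, map_add, Multiset.toFinsupp_singleton,
    Multiset.toFinsupp_singleton]

theorem exists_eq_single {s : ι →₀ ℕ} (hs : s.degree = 1) : ∃ i, s = Finsupp.single i 1 := by
  classical
  have hcard : s.toMultiset.card = 1 := by rw [Finsupp.card_toMultiset]; exact hs
  obtain ⟨i, h⟩ := Multiset.card_eq_one.1 hcard
  exact ⟨i, (Finsupp.toMultiset_eq_iff.1 h).trans (Multiset.toFinsupp_singleton i)⟩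

theorem evalAt_monomial (b : Module.Basis ι F2 W) (w : W) (i j : ι) (a : F2) :
    evalAt b w (MvPolynomial.monomial (Finsupp.single i 1 + Finsupp.single j 1) a) =
      a * (b.repr w i * b.repr w j) := by
  classical
  rw [evalAt, MvPolynomial.aeval_monomial, Finsupp.prod_add_index' (by simp)
    (fun _ _ _ => pow_add _ _ _)]
  simp

/-- A homogeneous quadratic polynomial over `F₂` is determined by its values: the coefficients of
`x_i²` and of `x_i x_j` can be read off at `b_i` and at `b_i + b_j`. -/
theorem eq_zero_of_evalAt (b : Module.Basis ι F2 W) {p : MvPolynomial ι F2}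
    (hp : p.IsHomogeneous 2) (h : ∀ w, evalAt b w p = 0) : p = 0 := by
  classical
  have hsum : ∀ w, ∑ s ∈ p.support, evalAt b w (MvPolynomial.monomial s (p.coeff s)) = 0 := by
    intro w
    rw [← map_sum, ← p.as_sum, h]
  have hdeg : ∀ s ∈ p.support, ∃ i j, s = Finsupp.single i 1 + Finsupp.single j 1 := fun s hs =>
    exists_eq_single_add_single (by
      by_contra hne
      exact MvPolynomial.mem_support_iff.1 hs (hp.coeff_eq_zero hne))
  have hdiag : ∀ i, p.coeff (Finsupp.single i 1 + Finsupp.single i 1) = 0 := by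
    intro i
    have := hsum (b i)
    rw [Finset.sum_eq_single (Finsupp.single i 1 + Finsupp.single i 1)] at this
    · simpa [evalAt_monomial] using this
    · intro s hs hne
      obtain ⟨a, c, rfl⟩ := hdeg s hs
      rw [evalAt_monomial]
      by_cases ha : i = a
      · by_cases hc : i = c
        · subst ha hc; exact absurd rfl hne
        · simp [hc]
      · simp [ha]
    · intro hs
      rw [MvPolynomial.notMem_support_iff.1 hs, map_zero, map_zero]
  ext s
  rw [MvPolynomial.coeff_zero]
  by_contra hs
  obtain ⟨i, j, rfl⟩ := hdeg s (MvPolynomial.mem_support_iff.2 hs)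
  have hij : i ≠ j := by rintro rfl; exact hs (hdiag i)
  have := hsum (b i + b j)
  rw [Finset.sum_eq_single (Finsupp.single i 1 + Finsupp.single j 1)] at this
  · apply hs
    simpa [evalAt_monomial, hij, hij.symm] using this
  · intro s hs hne
    obtain ⟨a, c, rfl⟩ := hdeg s hs
    rw [evalAt_monomial]
    by_cases hac : a = c
    · rw [← hac, hdiag, zero_mul]
    by_cases ha : a = i ∨ a = j
    · by_cases hc : c = i ∨ c = j
      · exfalso
        rcases ha with rfl | rfl <;> rcases hc with rfl | rfl
        · exact hac rfl
        · exact hne rfl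
        · exact hne (add_comm _ _)
        · exact hac rfl
      · push Not at hc
        simp [hc.1.symm, hc.2.symm]
    · push Not at ha
      simp [ha.1.symm, ha.2.symm]
  · intro hs
    rw [MvPolynomial.notMem_support_iff.1 hs, map_zero, map_zero]

theorem eq_of_evalAt (b : Module.Basis ι F2 W) {p q : MvPolynomial ι F2} (hp : p.IsHomogeneous 2)
    (hq : q.IsHomogeneous 2) (h : ∀ w, evalAt b w p = evalAt b w q) : p = q :=
  sub_eq_zero.1 (eq_zero_of_evalAt b (hp.sub hq) fun w => by rw [map_sub, h, sub_self])

theorem exists_polynomial_of_quadraticMap [Fintype ι] (b : Module.Basis ι F2 W)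
    (g : QuadraticMap F2 W F2) :
    ∃ p : MvPolynomial ι F2, p.IsHomogeneous 2 ∧ ∀ w, evalAt b w p = g w := by
  have : Module.Free F2 W := Module.Free.of_basis b
  obtain ⟨B, rfl⟩ := LinearMap.BilinMap.toQuadraticMap_surjective g
  refine ⟨∑ i, ∑ j, MvPolynomial.monomial (Finsupp.single i 1 + Finsupp.single j 1)
    (B (b i) (b j)), ?_, fun w => ?_⟩
  · exact .sum _ _ _ fun i _ => .sum _ _ _ fun j _ =>
      MvPolynomial.isHomogeneous_monomial _ (by simp)
  · conv_rhs => rw [LinearMap.BilinMap.toQuadraticMap_apply, ← b.sum_repr w]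
    simp only [map_sum, LinearMap.sum_apply, map_smul, LinearMap.smul_apply, evalAt_monomial,
      smul_eq_mul, Finset.mul_sum]
    rw [Finset.sum_comm]
    exact Finset.sum_congr rfl fun _ _ => Finset.sum_congr rfl fun _ _ => by ring

theorem exists_quadraticMap_of_polynomial (b : Module.Basis ι F2 W) {p : MvPolynomial ι F2}
    (hp : p.IsHomogeneous 2) : ∃ g : QuadraticMap F2 W F2, ∀ w, g w = evalAt b w p := by
  have hdeg : ∀ s : ι →₀ ℕ, ∃ g : QuadraticMap F2 W F2,
      ∀ w, g w = evalAt b w (MvPolynomial.monomial s (p.coeff s)) := by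
    intro s
    by_cases hs : s.degree = 2
    · obtain ⟨i, j, rfl⟩ := exists_eq_single_add_single hs
      refine ⟨p.coeff (Finsupp.single i 1 + Finsupp.single j 1) •
        QuadraticMap.linMulLin (b.coord i) (b.coord j), fun w => ?_⟩
      rw [evalAt_monomial]
      rfl
    · exact ⟨0, fun w => by rw [hp.coeff_eq_zero hs, map_zero, map_zero]; rfl⟩
  choose g hg using hdeg
  refine ⟨∑ s ∈ p.support, g s, fun w => ?_⟩
  rw [_root_.sum_apply]
  conv_rhs => rw [p.as_sum, map_sum]
  exact Finset.sum_congr rfl fun s _ => hg s w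

theorem exists_isComponent [Fintype ι] (b : Module.Basis ι F2 W) (Q : QuadraticMap F2 W V)
    (φ : Module.Dual F2 V) : ∃ p, IsComponent b Q φ p :=
  exists_polynomial_of_quadraticMap b (φ.compQuadraticMap Q)

theorem mem_classIdeal_of_isComponent {b : Module.Basis ι F2 W} {Q : QuadraticMap F2 W V}
    {φ : Module.Dual F2 V} {p : MvPolynomial ι F2} (h : IsComponent b Q φ p) :
    p ∈ classIdeal b Q :=
  Ideal.subset_span ⟨φ, h⟩

end QuadraticPolynomials

/-! ### Homogeneous parts of ideals generated by quadratic polynomials -/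

section Homogeneous

variable {ι W V : Type*} [AddCommGroup W] [Module F2 W] [AddCommGroup V] [Module F2 V]

/-- The part of degree `n + 2` of an ideal generated by quadratic polynomials is spanned by the
products of the generators with the monomials of degree `n`. -/
theorem mem_span_monomial_mul {S : Set (MvPolynomial ι F2)} (hS : ∀ g ∈ S, g.IsHomogeneous 2)
    {n : ℕ} {p : MvPolynomial ι F2} (hp : p.IsHomogeneous (n + 2)) (h : p ∈ Ideal.span S) :
    p ∈ Submodule.span F2 {r | ∃ s : ι →₀ ℕ, s.degree = n ∧ ∃ g ∈ S,
      r = MvPolynomial.monomial s 1 * g} := by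
  have htop : Submodule.span F2 (Set.range fun s : ι →₀ ℕ =>
      (MvPolynomial.monomial s 1 : MvPolynomial ι F2)) = ⊤ := by
    simpa using (MvPolynomial.basisMonomials ι F2).span_eq
  have h' : p ∈ (Ideal.span S).restrictScalars F2 := h
  rw [Ideal.span, ← Submodule.span_smul_of_span_eq_top htop] at h'
  have hself : MvPolynomial.homogeneousComponent (n + 2) p = p := by
    rw [MvPolynomial.homogeneousComponent_of_mem hp, if_pos rfl]
  rw [← hself]
  clear hself hp h
  induction h' using Submodule.span_induction with
  | zero => rw [map_zero]; exact zero_mem _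
  | add x y _ _ hx hy => rw [map_add]; exact add_mem hx hy
  | smul a x _ hx => rw [map_smul]; exact Submodule.smul_mem _ a hx
  | mem x hx =>
    obtain ⟨_, ⟨s, rfl⟩, g, hg, rfl⟩ := hx
    have hom : (MvPolynomial.monomial s (1 : F2) * g).IsHomogeneous (s.degree + 2) :=
      (MvPolynomial.isHomogeneous_monomial 1 rfl).mul (hS g hg)
    change MvPolynomial.homogeneousComponent (n + 2) (MvPolynomial.monomial s (1 : F2) * g) ∈ _
    rw [MvPolynomial.homogeneousComponent_of_mem hom]
    split_ifs with hn
    · exact Submodule.subset_span ⟨s, by omega, g, hg, rfl⟩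
    · exact zero_mem _

/-- The quadratic polynomials in `I(Q)` are exactly the components of the extension class. -/
theorem exists_isComponent_of_mem (b : Module.Basis ι F2 W) (Q : QuadraticMap F2 W V)
    {p : MvPolynomial ι F2} (hp : p.IsHomogeneous 2) (h : p ∈ classIdeal b Q) :
    ∃ φ : Module.Dual F2 V, IsComponent b Q φ p := by
  have := mem_span_monomial_mul (n := 0) (fun g hg => hg.choose_spec.1) hp h
  clear hp h
  induction this using Submodule.span_induction with
  | zero => exact ⟨0, MvPolynomial.isHomogeneous_zero _ _ _, fun w => by simp⟩
  | add x y _ _ hx hy =>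
    obtain ⟨φ, hφ, hφ'⟩ := hx
    obtain ⟨ψ, hψ, hψ'⟩ := hy
    exact ⟨φ + ψ, hφ.add hψ, fun w => by rw [map_add, hφ', hψ']; rfl⟩
  | smul a x _ hx =>
    obtain ⟨φ, hφ, hφ'⟩ := hx
    exact ⟨a • φ, (MvPolynomial.homogeneousSubmodule ι F2 2).smul_mem a hφ, fun w => by
      rw [map_smul, hφ']; rfl⟩
  | mem x hx =>
    obtain ⟨s, hs, g, ⟨φ, hφ⟩, rfl⟩ := hx
    rw [Finsupp.degree_eq_zero_iff] at hs
    subst hs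
    exact ⟨φ, by simpa using hφ⟩

end Homogeneous

/-! ### A normal form functional -/

section NormalForm

variable {κ A : Type*} [CommRing A]

theorem single_two_add_single_one_inj {k l k' l' : κ}
    (h : (Finsupp.single k 2 + Finsupp.single l 1 : κ →₀ ℕ) =
      Finsupp.single k' 2 + Finsupp.single l' 1) : k = k' ∧ l = l' := by
  classical
  have hk : k = k' := by
    by_contra hne
    have h1 := DFunLike.congr_fun h k
    simp only [Finsupp.add_apply, Finsupp.single_apply] at h1
    grind
  subst hk
  exact ⟨rfl, Finsupp.single_left_injective one_ne_zero (add_left_cancel h)⟩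

variable [Fintype κ]

/-- The quadratic relation `z_k² + ∑_l R_{kl} z_l + f_k` in the variables `z`. -/
def quadRel (R : κ → κ → A) (f : κ → A) (k : κ) : MvPolynomial κ A :=
  MvPolynomial.X k ^ 2 + ∑ l, MvPolynomial.C (R k l) * MvPolynomial.X l + MvPolynomial.C (f k)

open MvPolynomial in
/-- The constant term of the reduction of a polynomial of degree at most three modulo the relations
`quadRel R f`: the monomial `z_l²` reduces to `f_l` and `z_k² z_l` to `R_{kl} f_l`, up to terms
without constant part. -/
def constTerm (R : κ → κ → A) (f : κ → A) : MvPolynomial κ A →ₗ[A] A :=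
  lcoeff A 0 + ∑ l, f l • lcoeff A (Finsupp.single l 2) +
    ∑ k, ∑ l, (R k l * f l) • lcoeff A (Finsupp.single k 2 + Finsupp.single l 1)

variable (R : κ → κ → A) (f : κ → A)

theorem constTerm_C (a : A) : constTerm R f (MvPolynomial.C a) = a := by
  classical
  have h2 : ∀ l : κ, (0 : κ →₀ ℕ) ≠ Finsupp.single l 2 := fun l h => by
    simpa using congrArg Finsupp.degree h
  have h3 : ∀ k l : κ, (0 : κ →₀ ℕ) ≠ Finsupp.single k 2 + Finsupp.single l 1 := fun k l h => by
    simpa using congrArg Finsupp.degree h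
  simp [constTerm, MvPolynomial.coeff_C, h2, h3]

theorem constTerm_X (m : κ) : constTerm R f (MvPolynomial.X m) = 0 := by
  classical
  have h2 : ∀ l : κ, Finsupp.single m 1 ≠ Finsupp.single l 2 := fun l h => by
    simpa using congrArg Finsupp.degree h
  have h3 : ∀ k l : κ, Finsupp.single m 1 ≠ Finsupp.single k 2 + Finsupp.single l 1 :=
    fun k l h => by simpa using congrArg Finsupp.degree h
  simp [constTerm, MvPolynomial.coeff_X, h2, h3]

theorem constTerm_X_mul_X [DecidableEq κ] (l m : κ) :
    constTerm R f (MvPolynomial.X l * MvPolynomial.X m) = if l = m then f l else 0 := by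
  have e : (MvPolynomial.X l * MvPolynomial.X m : MvPolynomial κ A) =
      MvPolynomial.monomial (Finsupp.single l 1 + Finsupp.single m 1) 1 := by
    simp [MvPolynomial.X, MvPolynomial.monomial_mul]
  have h1 : Finsupp.single l 1 + Finsupp.single m 1 ≠ (0 : κ →₀ ℕ) := fun h => by
    simpa using congrArg Finsupp.degree h
  have h2 : ∀ k : κ, Finsupp.single l 1 + Finsupp.single m 1 = Finsupp.single k 2 ↔
      l = k ∧ m = k := fun k => by
    constructor
    · intro h
      have := DFunLike.congr_fun h k
      simp only [Finsupp.add_apply, Finsupp.single_apply] at this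
      grind
    · rintro ⟨rfl, rfl⟩
      rw [← Finsupp.single_add]
  have h3 : ∀ k j : κ, Finsupp.single l 1 + Finsupp.single m 1 ≠
      Finsupp.single k 2 + Finsupp.single j 1 := fun k j h => by
    simpa using congrArg Finsupp.degree h
  simp only [constTerm, e, LinearMap.add_apply, LinearMap.sum_apply, LinearMap.smul_apply,
    MvPolynomial.lcoeff_apply, MvPolynomial.coeff_monomial, h1, h2, h3, if_false, smul_eq_mul,
    mul_zero, Finset.sum_const_zero, zero_add, add_zero, mul_ite, mul_one]
  split_ifs with h
  · subst h
    simp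
  · exact Finset.sum_eq_zero fun k _ => if_neg fun hk => h (hk.1.trans hk.2.symm)

theorem constTerm_X_mul_X_sq (l k : κ) :
    constTerm R f (MvPolynomial.X l * MvPolynomial.X k ^ 2) = R k l * f l := by
  classical
  have e : (MvPolynomial.X l * MvPolynomial.X k ^ 2 : MvPolynomial κ A) =
      MvPolynomial.monomial (Finsupp.single k 2 + Finsupp.single l 1) 1 := by
    simp [MvPolynomial.X, MvPolynomial.monomial_mul, MvPolynomial.monomial_pow, add_comm]
  have h1 : Finsupp.single k 2 + Finsupp.single l 1 ≠ (0 : κ →₀ ℕ) := fun h => by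
    simpa using congrArg Finsupp.degree h
  have h2 : ∀ j : κ, Finsupp.single k 2 + Finsupp.single l 1 ≠ Finsupp.single j 2 := fun j h => by
    simpa using congrArg Finsupp.degree h
  have h3 : ∀ k' l' : κ, Finsupp.single k 2 + Finsupp.single l 1 =
      Finsupp.single k' 2 + Finsupp.single l' 1 ↔ k = k' ∧ l = l' := fun k' l' =>
    ⟨single_two_add_single_one_inj, by rintro ⟨rfl, rfl⟩; rfl⟩
  simp only [constTerm, e, LinearMap.add_apply, LinearMap.sum_apply, LinearMap.smul_apply,
    MvPolynomial.lcoeff_apply, MvPolynomial.coeff_monomial, h1, h2, h3, if_false, smul_eq_mul,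
    mul_zero, Finset.sum_const_zero, zero_add, mul_ite, mul_one, ite_and]
  rw [Finset.sum_eq_single k (fun j _ hj => by simp [hj.symm]) (by simp)]
  simp

theorem constTerm_C_mul (a : A) (p : MvPolynomial κ A) :
    constTerm R f (MvPolynomial.C a * p) = a * constTerm R f p := by
  rw [← MvPolynomial.smul_eq_C_mul, map_smul, smul_eq_mul]

theorem constTerm_quadRel (h2 : ∀ a : A, a + a = 0) (k : κ) :
    constTerm R f (quadRel R f k) = 0 := by
  classical
  simp only [quadRel, map_add, map_sum, constTerm_C_mul, constTerm_X, constTerm_C, pow_two,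
    constTerm_X_mul_X, if_true, mul_zero, Finset.sum_const_zero, add_zero, h2]

theorem constTerm_X_mul_quadRel (h2 : ∀ a : A, a + a = 0) (l k : κ) :
    constTerm R f (MvPolynomial.X l * quadRel R f k) = 0 := by
  classical
  simp only [quadRel, mul_add, Finset.mul_sum, mul_left_comm (MvPolynomial.X l), map_add, map_sum,
    constTerm_C_mul, constTerm_X_mul_X, constTerm_X_mul_X_sq,
    mul_comm (MvPolynomial.X l) (MvPolynomial.C _), constTerm_X, mul_ite, mul_zero,
    Finset.sum_ite_eq, Finset.mem_univ, if_true, h2]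

end NormalForm

/-! ### The quadratic map of a factor set -/

section ExtQuad

variable {W V U : Type*} [AddCommGroup W] [Module F2 W] [AddCommGroup V] [Module F2 V]
  [AddCommGroup U] [Module F2 U] {Q : QuadraticMap F2 W V}

/-- The quadratic map `U × W → U × V`, `(u, w) ↦ (u + ρ_W(w) u + f(w), Q(w))`: the middle term of
the extension with factor set `f`. -/
def extQuad (ρ : Representation U Q) (f : QuadraticMap F2 W U) :
    QuadraticMap F2 (U × W) (U × V) :=
  (LinearMap.inl F2 U V).compQuadraticMap
      ((idQuad U).comp (LinearMap.fst F2 U W) +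
        LinearMap.BilinMap.toQuadraticMap
          (ρ.onW.compl₁₂ (LinearMap.snd F2 U W) (LinearMap.fst F2 U W)) +
        f.comp (LinearMap.snd F2 U W)) +
    (LinearMap.inr F2 U V).compQuadraticMap (Q.comp (LinearMap.snd F2 U W))

theorem extQuad_apply (ρ : Representation U Q) (f : QuadraticMap F2 W U) (x : U × W) :
    extQuad ρ f x = (x.1 + ρ.onW x.2 x.1 + f x.2, Q x.2) := by
  change ((x.1 + ρ.onW x.2 x.1 + f x.2, 0) : U × V) + (0, Q x.2) = _
  rw [Prod.mk_add_mk, add_zero, zero_add]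

end ExtQuad

/-! ### The ideal of the quadratic map of a factor set -/

section ExtIdeal

variable {ι κ W V U : Type*} [AddCommGroup W] [Module F2 W] [AddCommGroup V] [Module F2 V]
  [AddCommGroup U] [Module F2 U] {Q : QuadraticMap F2 W V}
  (b : Module.Basis ι F2 W) (m : Module.Basis κ F2 U) (ρ : Representation U Q)

theorem evalAt_rename_inr (x : U × W) (p : MvPolynomial ι F2) :
    evalAt (m.prod b) x (MvPolynomial.rename Sum.inr p) = evalAt b x.2 p := by
  rw [evalAt, MvPolynomial.aeval_rename]
  rfl

theorem evalAt_X_inl (x : U × W) (k : κ) :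
    evalAt (m.prod b) x (MvPolynomial.X (Sum.inl k)) = m.repr x.1 k := by
  rw [evalAt, MvPolynomial.aeval_X]
  rfl

theorem bockstein_C_mul (a : F2) (p : MvPolynomial ι F2) :
    bockstein ι (MvPolynomial.C a * p) = MvPolynomial.C a * bockstein ι p := by
  rw [← MvPolynomial.smul_eq_C_mul, Derivation.map_smul, MvPolynomial.smul_eq_C_mul]

variable [Fintype ι]

/-- The entry at `(k, l)` of the matrix of linear forms which represents `ρ_W`. -/
def matR (k l : κ) : MvPolynomial ι F2 :=
  ∑ i, MvPolynomial.C (m.repr (ρ.onW (b i) (m l)) k) * MvPolynomial.X i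

theorem isHomogeneous_matR (k l : κ) : (matR b m ρ k l).IsHomogeneous 1 :=
  .sum _ _ _ fun i _ => by
    simpa using (MvPolynomial.isHomogeneous_C ι _).mul (MvPolynomial.isHomogeneous_X F2 i)

theorem evalAt_matR (w : W) (k l : κ) :
    evalAt b w (matR b m ρ k l) = m.repr (ρ.onW w (m l)) k := by
  conv_rhs => rw [← b.sum_repr w]
  simp only [matR, evalAt, map_sum, map_smul, map_mul, MvPolynomial.aeval_X,
    LinearMap.sum_apply, LinearMap.smul_apply, Finsupp.finsetSum_apply, Finsupp.smul_apply,
    smul_eq_mul, MvPolynomial.aeval_C]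
  exact Finset.sum_congr rfl fun i _ => mul_comm _ _

theorem evalAt_bockstein_matR (w : W) (k l : κ) :
    evalAt b w (bockstein ι (matR b m ρ k l)) = m.repr (ρ.onW w (m l)) k := by
  rw [← evalAt_matR b m ρ w k l]
  simp only [matR, map_sum, bockstein_C_mul, bockstein_X, map_mul, evalAt,
    MvPolynomial.aeval_X, pow_two, F2.mul_self]

variable [Fintype κ]

/-- The coordinates of `δ(∑ t_k ⊗ m_k)`. -/
def deltaCoord (t : κ → MvPolynomial ι F2) (k : κ) : MvPolynomial ι F2 :=
  bockstein ι (t k) + ∑ l, matR b m ρ k l * t l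

/-- The component along the `k`-th coordinate of `U` of the quadratic map with factor set
`∑ t_k ⊗ m_k`. The variables are the coordinates `Sum.inl k` of `U` and `Sum.inr i` of `W`. -/
def extPoly (t : κ → MvPolynomial ι F2) (k : κ) : MvPolynomial (κ ⊕ ι) F2 :=
  MvPolynomial.X (Sum.inl k) ^ 2 +
    ∑ l, MvPolynomial.rename Sum.inr (matR b m ρ k l) * MvPolynomial.X (Sum.inl l) +
    MvPolynomial.rename Sum.inr (t k)

theorem repr_apply_eq_sum (A : Module.End F2 U) (u : U) (k : κ) :
    m.repr (A u) k = ∑ l, m.repr (A (m l)) k * m.repr u l := by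
  conv_lhs => rw [← m.sum_repr u]
  simp only [map_sum, map_smul, Finsupp.finsetSum_apply, Finsupp.smul_apply, smul_eq_mul]
  exact Finset.sum_congr rfl fun l _ => mul_comm _ _

/-- The entries of `β(R) + R²` are components of the extension class of `Q`, since
`ρ_W(w)² + ρ_W(w) = ρ_V(Q(w))`. -/
theorem bockstein_matR_add_mem (k j : κ) :
    bockstein ι (matR b m ρ k j) + ∑ l, matR b m ρ k l * matR b m ρ l j ∈ classIdeal b Q := by
  refine mem_classIdeal_of_isComponent (φ := m.coord k ∘ₗ LinearMap.applyₗ (m j) ∘ₗ ρ.onV) ⟨?_, ?_⟩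
  · exact (bockstein_isHomogeneous (isHomogeneous_matR b m ρ k j)).add
      (.sum _ _ _ fun l _ => (isHomogeneous_matR b m ρ k l).mul (isHomogeneous_matR b m ρ l j))
  · intro w
    simp only [LinearMap.comp_apply, ← ρ.comm, LinearMap.applyₗ_apply_apply,
      Module.Basis.coord_apply]
    change _ = m.repr (ρ.onW w (ρ.onW w (m j)) + ρ.onW w (m j)) k
    rw [map_add m.repr, Finsupp.add_apply, repr_apply_eq_sum m (ρ.onW w) (ρ.onW w (m j)),
      add_comm (∑ l, _)]
    simp only [map_add, map_sum, map_mul, evalAt_bockstein_matR, evalAt_matR]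

theorem bockstein_rename {σ τ : Type*} (g : σ → τ) (p : MvPolynomial σ F2) :
    bockstein τ (MvPolynomial.rename g p) = MvPolynomial.rename g (bockstein σ p) := by
  induction p using MvPolynomial.induction_on with
  | C a => simp [bockstein]
  | add p q hp hq => simp only [map_add, hp, hq]
  | mul_X p i hp =>
    simp only [map_mul, Derivation.leibniz, hp, smul_eq_mul, map_add, bockstein_X, map_pow,
      MvPolynomial.rename_X]

/-- The Bockstein of `z_k² + ∑ R_{kl} z_l + t_k`, rewritten with the help of these relations. -/
theorem bockstein_extPoly (t : κ → MvPolynomial ι F2) (k : κ) :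
    bockstein (κ ⊕ ι) (extPoly b m ρ t k) =
      ∑ l, MvPolynomial.rename Sum.inr (matR b m ρ k l) * extPoly b m ρ t l +
      ∑ j, MvPolynomial.rename Sum.inr (bockstein ι (matR b m ρ k j) +
        ∑ l, matR b m ρ k l * matR b m ρ l j) * MvPolynomial.X (Sum.inl j) +
      MvPolynomial.rename Sum.inr (deltaCoord b m ρ t k) := by
  have h2 : ∀ p : MvPolynomial (κ ⊕ ι) F2, p + p = 0 := F2poly_add_self
  have hcomm : ∑ j, (∑ l, MvPolynomial.rename Sum.inr (matR b m ρ k l) *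
        MvPolynomial.rename Sum.inr (matR b m ρ l j)) * MvPolynomial.X (Sum.inl j) =
      ∑ l, MvPolynomial.rename (Sum.inr : ι → κ ⊕ ι) (matR b m ρ k l) *
        ∑ j, MvPolynomial.rename Sum.inr (matR b m ρ l j) * MvPolynomial.X (Sum.inl j) := by
    simp only [Finset.sum_mul, Finset.mul_sum, mul_assoc]
    exact Finset.sum_comm
  simp only [extPoly, deltaCoord, map_add, map_sum, map_mul, Derivation.leibniz, pow_two,
    bockstein_X, bockstein_rename, smul_eq_mul, mul_add, add_mul, Finset.sum_add_distrib, hcomm,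
    h2, zero_add]
  have e : ∀ j, MvPolynomial.X (Sum.inl j) *
        MvPolynomial.rename Sum.inr (bockstein ι (matR b m ρ k j)) =
      MvPolynomial.rename (Sum.inr : ι → κ ⊕ ι) (bockstein ι (matR b m ρ k j)) *
        MvPolynomial.X (Sum.inl j) := fun j => mul_comm _ _
  simp only [e]
  linear_combination (-∑ l, MvPolynomial.rename (Sum.inr : ι → κ ⊕ ι) (matR b m ρ k l) *
        ∑ j, MvPolynomial.rename Sum.inr (matR b m ρ l j) * MvPolynomial.X (Sum.inl j) -
      ∑ l, MvPolynomial.rename (Sum.inr : ι → κ ⊕ ι) (matR b m ρ k l) *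
        MvPolynomial.rename Sum.inr (t l)) *
    (CharTwo.two_eq_zero (R := MvPolynomial (κ ⊕ ι) F2))

variable {f : QuadraticMap F2 W U} {t : κ → MvPolynomial ι F2}

theorem isHomogeneous_extPoly (ht : ∀ k, (t k).IsHomogeneous 2) (k : κ) :
    (extPoly b m ρ t k).IsHomogeneous 2 := by
  refine .add (.add ?_ (.sum _ _ _ fun l _ => ?_)) (ht k).rename_isHomogeneous
  · simpa using (MvPolynomial.isHomogeneous_X F2 (Sum.inl k : κ ⊕ ι)).pow 2
  · exact (isHomogeneous_matR b m ρ k l).rename_isHomogeneous.mul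
      (MvPolynomial.isHomogeneous_X F2 _)

theorem evalAt_extPoly (hf : ∀ w k, evalAt b w (t k) = m.repr (f w) k) (x : U × W) (k : κ) :
    evalAt (m.prod b) x (extPoly b m ρ t k) = m.repr (extQuad ρ f x).1 k := by
  rw [extQuad_apply, map_add, map_add, Finsupp.add_apply, Finsupp.add_apply,
    repr_apply_eq_sum m (ρ.onW x.2)]
  simp only [extPoly, map_add, map_sum, map_mul, evalAt_rename_inr, evalAt_X_inl,
    evalAt_matR, hf, pow_two, F2.mul_self]

/-- The ideal of the extension is generated by the relations for the coordinates of `U` and by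
`I(Q)`. -/
theorem classIdeal_extQuad (ht : ∀ k, (t k).IsHomogeneous 2)
    (hf : ∀ w k, evalAt b w (t k) = m.repr (f w) k) :
    classIdeal (m.prod b) (extQuad ρ f) =
      Ideal.span (Set.range (extPoly b m ρ t) ∪
        MvPolynomial.rename Sum.inr '' {p | ∃ φ : Module.Dual F2 V, IsComponent b Q φ p}) := by
  apply le_antisymm
  · refine Ideal.span_le.2 ?_
    rintro p ⟨φ, hp, hφ⟩
    obtain ⟨q, hq, hq'⟩ := exists_isComponent b Q (φ ∘ₗ LinearMap.inr F2 U V)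
    have e : p = ∑ k, MvPolynomial.C (φ (m k, 0)) * extPoly b m ρ t k +
        MvPolynomial.rename Sum.inr q := by
      refine eq_of_evalAt (m.prod b) hp
        (.add (.sum _ _ _ fun k _ => ?_) hq.rename_isHomogeneous) fun x => ?_
      · simpa using (MvPolynomial.isHomogeneous_C _ _).mul (isHomogeneous_extPoly b m ρ ht k)
      · rw [hφ, map_add, evalAt_rename_inr, hq']
        have hx : extQuad ρ f x = LinearMap.inl F2 U V (extQuad ρ f x).1 +
            LinearMap.inr F2 U V (Q x.2) := by
          rw [extQuad_apply]
          simp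
        conv_lhs => rw [hx, map_add, ← m.sum_repr (extQuad ρ f x).1]
        simp only [map_sum, map_mul, evalAt_extPoly b m ρ hf, map_smul, smul_eq_mul]
        refine congrArg₂ _ (Finset.sum_congr rfl fun k _ => ?_) rfl
        rw [mul_comm]
        simp [evalAt]
    rw [e]
    refine add_mem (sum_mem fun k _ => Ideal.mul_mem_left _ _ ?_) ?_
    · exact Ideal.subset_span (Or.inl ⟨k, rfl⟩)
    · exact Ideal.subset_span (Or.inr ⟨q, ⟨_, hq, hq'⟩, rfl⟩)
  · refine Ideal.span_le.2 ?_
    rintro p (⟨k, rfl⟩ | ⟨q, ⟨φ, hq, hq'⟩, rfl⟩)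
    · exact mem_classIdeal_of_isComponent (φ := m.coord k ∘ₗ LinearMap.fst F2 U V)
        ⟨isHomogeneous_extPoly b m ρ ht k, fun x => evalAt_extPoly b m ρ hf x k⟩
    · refine mem_classIdeal_of_isComponent (φ := φ ∘ₗ LinearMap.snd F2 U V)
        ⟨hq.rename_isHomogeneous, fun x => ?_⟩
      rw [evalAt_rename_inr, hq', extQuad_apply]
      rfl

theorem rename_mem_classIdeal (ht : ∀ k, (t k).IsHomogeneous 2)
    (hf : ∀ w k, evalAt b w (t k) = m.repr (f w) k) {p : MvPolynomial ι F2}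
    (hp : p ∈ classIdeal b Q) :
    MvPolynomial.rename Sum.inr p ∈ classIdeal (m.prod b) (extQuad ρ f) := by
  rw [classIdeal_extQuad b m ρ ht hf]
  have h : classIdeal b Q ≤ (Ideal.span (Set.range (extPoly b m ρ t) ∪ MvPolynomial.rename Sum.inr ''
      {p | ∃ φ : Module.Dual F2 V, IsComponent b Q φ p})).comap
      (MvPolynomial.rename (Sum.inr : ι → κ ⊕ ι)) :=
    Ideal.span_le.2 fun q hq => Ideal.subset_span (Or.inr ⟨q, hq, rfl⟩)
  exact h hp

/-- `A^*(Q)` embeds in degree three into the algebra of the extension. In `A^*(Q)[z]`, the part of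
degree three of the ideal is spanned by products of the relations with a variable, and these have
constant term zero. -/
theorem mem_of_rename_mem_classIdeal (ht : ∀ k, (t k).IsHomogeneous 2)
    (hf : ∀ w k, evalAt b w (t k) = m.repr (f w) k) {p : MvPolynomial ι F2}
    (hp : p.IsHomogeneous 3)
    (h : MvPolynomial.rename Sum.inr p ∈ classIdeal (m.prod b) (extQuad ρ f)) :
    p ∈ classIdeal b Q := by
  let θ : MvPolynomial (κ ⊕ ι) F2 →ₐ[F2] MvPolynomial κ (AlgA b Q) :=
    MvPolynomial.aeval (Sum.elim MvPolynomial.X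
      fun i => MvPolynomial.C (toA b Q (MvPolynomial.X i)))
  let R : κ → κ → AlgA b Q := fun k l => toA b Q (matR b m ρ k l)
  let g : κ → AlgA b Q := fun k => toA b Q (t k)
  have h2 : ∀ a : AlgA b Q, a + a = 0 := fun a => by
    obtain ⟨a, rfl⟩ := Ideal.Quotient.mkₐ_surjective F2 _ a
    rw [← map_add, F2poly_add_self, map_zero]
  have hren : ∀ q, θ (MvPolynomial.rename Sum.inr q) = MvPolynomial.C (toA b Q q) := by
    intro q
    induction q using MvPolynomial.induction_on with
    | C a =>
      rw [MvPolynomial.rename_C, MvPolynomial.algHom_C, MvPolynomial.algHom_C]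
      rfl
    | add p q hp hq => simp only [map_add, hp, hq]
    | mul_X p i hp =>
      rw [map_mul, map_mul, hp, map_mul, map_mul, MvPolynomial.rename_X, MvPolynomial.aeval_X]
      rfl
  have hext : ∀ k, θ (extPoly b m ρ t k) = quadRel R g k := by
    intro k
    simp only [extPoly, quadRel, map_add, map_sum, map_mul, map_pow, hren]
    simp only [θ, MvPolynomial.aeval_X, Sum.elim_inl]
    rfl
  have h3 := mem_span_monomial_mul (n := 1) ?_ hp.rename_isHomogeneous
    (classIdeal_extQuad b m ρ ht hf ▸ h)
  · have h0 : ∀ q ∈ Submodule.span F2 {r | ∃ s : κ ⊕ ι →₀ ℕ, s.degree = 1 ∧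
        ∃ g ∈ Set.range (extPoly b m ρ t) ∪ MvPolynomial.rename Sum.inr ''
          {p | ∃ φ : Module.Dual F2 V, IsComponent b Q φ p},
        r = MvPolynomial.monomial s 1 * g}, constTerm R g (θ q) = 0 := by
      intro q hq
      induction hq using Submodule.span_induction with
      | zero => rw [map_zero, map_zero]
      | add x y _ _ hx hy => rw [map_add, map_add, hx, hy, add_zero]
      | smul a x _ hx => rw [map_smul, LinearMap.map_smul_of_tower, hx, smul_zero]
      | mem x hx =>
        obtain ⟨s, hs, q, hq, rfl⟩ := hx
        obtain ⟨j, rfl⟩ := exists_eq_single hs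
        change constTerm R g (θ (MvPolynomial.X j * q)) = 0
        rw [map_mul]
        rcases hq with ⟨k, rfl⟩ | ⟨q, hq, rfl⟩
        · rw [hext]
          rcases j with l | i
          · rw [MvPolynomial.aeval_X]
            exact constTerm_X_mul_quadRel R g h2 l k
          · rw [MvPolynomial.aeval_X, Sum.elim_inr, constTerm_C_mul, constTerm_quadRel R g h2,
              mul_zero]
        · have : toA b Q q = 0 := Ideal.Quotient.eq_zero_iff_mem.2 (Ideal.subset_span hq)
          rw [hren, this, map_zero, mul_zero, map_zero]
    have := h0 _ h3
    rw [hren, constTerm_C] at this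
    exact Ideal.Quotient.eq_zero_iff_mem.1 this
  · rintro q (⟨k, rfl⟩ | ⟨q, ⟨φ, hq, -⟩, rfl⟩)
    · exact isHomogeneous_extPoly b m ρ ht k
    · exact hq.rename_isHomogeneous

theorem isHomogeneous_deltaCoord (ht : ∀ k, (t k).IsHomogeneous 2) (k : κ) :
    (deltaCoord b m ρ t k).IsHomogeneous 3 := by
  refine (bockstein_isHomogeneous (ht k)).add (.sum _ _ _ fun l _ => ?_)
  exact (isHomogeneous_matR b m ρ k l).mul (ht l)

/-- A derivation maps an ideal into itself as soon as it maps the generators into the ideal. -/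
theorem bockstein_mem_span {σ : Type*} {S : Set (MvPolynomial σ F2)}
    (h : ∀ g ∈ S, bockstein σ g ∈ Ideal.span S) {p : MvPolynomial σ F2} (hp : p ∈ Ideal.span S) :
    bockstein σ p ∈ Ideal.span S := by
  induction hp using Submodule.span_induction with
  | zero => rw [map_zero]; exact zero_mem _
  | add x y _ _ hx hy => rw [map_add]; exact add_mem hx hy
  | mem x hx => exact h x hx
  | smul a x hx' hx =>
    rw [smul_eq_mul, Derivation.leibniz, smul_eq_mul, smul_eq_mul]
    exact add_mem (Ideal.mul_mem_left _ _ hx) (Ideal.mul_mem_right _ _ hx')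

/-- The quadratic map with factor set `∑ t_k ⊗ m_k` is Bockstein closed if and only if the
coordinates of `δ(∑ t_k ⊗ m_k)` vanish in `A^*(Q)`. -/
theorem isBocksteinClosed_extQuad_iff (hQ : IsBocksteinClosed Q)
    (ht : ∀ k, (t k).IsHomogeneous 2) (hf : ∀ w k, evalAt b w (t k) = m.repr (f w) k) :
    IsBocksteinClosed (extQuad ρ f) ↔ ∀ k, deltaCoord b m ρ t k ∈ classIdeal b Q := by
  have hgen : ∀ k, extPoly b m ρ t k ∈ classIdeal (m.prod b) (extQuad ρ f) := fun k => by
    rw [classIdeal_extQuad b m ρ ht hf]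
    exact Ideal.subset_span (Or.inl ⟨k, rfl⟩)
  have hrest : ∀ k, ∑ l, MvPolynomial.rename Sum.inr (matR b m ρ k l) * extPoly b m ρ t l +
      ∑ j, MvPolynomial.rename Sum.inr (bockstein ι (matR b m ρ k j) +
        ∑ l, matR b m ρ k l * matR b m ρ l j) * MvPolynomial.X (Sum.inl j) ∈
      classIdeal (m.prod b) (extQuad ρ f) := fun k =>
    add_mem (sum_mem fun l _ => Ideal.mul_mem_left _ _ (hgen l)) (sum_mem fun j _ =>
      Ideal.mul_mem_right _ _
        (rename_mem_classIdeal b m ρ ht hf (bockstein_matR_add_mem b m ρ k j)))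
  rw [isBocksteinClosed_iff (m.prod b)]
  constructor
  · intro h k
    have hk := h _ (hgen k)
    rw [bockstein_extPoly, Ideal.add_mem_iff_right _ (hrest k)] at hk
    exact mem_of_rename_mem_classIdeal b m ρ ht hf (isHomogeneous_deltaCoord b m ρ ht k) hk
  · intro h p hp
    rw [classIdeal_extQuad b m ρ ht hf] at hp ⊢
    refine bockstein_mem_span ?_ hp
    rw [← classIdeal_extQuad b m ρ ht hf]
    rintro q (⟨k, rfl⟩ | ⟨q, hq, rfl⟩)
    · rw [bockstein_extPoly, Ideal.add_mem_iff_right _ (hrest k)]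
      exact rename_mem_classIdeal b m ρ ht hf (h k)
    · rw [bockstein_rename]
      exact rename_mem_classIdeal b m ρ ht hf
        ((isBocksteinClosed_iff b Q).1 hQ q (Ideal.subset_span hq))

end ExtIdeal

/-! ### Cochains in coordinates -/

section Coordinates

variable {ι κ W V U : Type*} [AddCommGroup W] [Module F2 W] [AddCommGroup V] [Module F2 V]
  [AddCommGroup U] [Module F2 U]

theorem sum_tmul_basis_eq_zero_iff {A : Type*} [AddCommGroup A] [Module F2 A] [Fintype κ]
    (m : Module.Basis κ F2 U) (a : κ → A) : ∑ k, a k ⊗ₜ[F2] m k = 0 ↔ ∀ k, a k = 0 := by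
  classical
  constructor
  · intro h k
    have := DFunLike.congr_fun (congrArg (TensorProduct.equivFinsuppOfBasisRight (M := A) m) h) k
    simpa [Finsupp.finsetSum_apply, Finsupp.single_apply, ite_smul] using this
  · intro h
    simp [h]

theorem exists_coordinates [Fintype κ] (m : Module.Basis κ F2 U) (n : ℕ)
    {T : MvPolynomial ι F2 ⊗[F2] U}
    (hT : T ∈ LinearMap.range ((MvPolynomial.homogeneousSubmodule ι F2 n).subtype.rTensor U)) :
    ∃ t : κ → MvPolynomial ι F2, (∀ k, (t k).IsHomogeneous n) ∧ T = ∑ k, t k ⊗ₜ[F2] m k := by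
  classical
  obtain ⟨S, rfl⟩ := hT
  obtain ⟨s, rfl⟩ := TensorProduct.eq_repr_basis_right m S
  refine ⟨fun k => (s k).1, fun k => (s k).2, ?_⟩
  rw [Finsupp.sum_fintype _ _ (by simp), map_sum]
  rfl

variable (b : Module.Basis ι F2 W) {Q : QuadraticMap F2 W V}

theorem exists_represents_coordinates [Fintype κ] (m : Module.Basis κ F2 U) {n : ℕ}
    {c : AlgA b Q ⊗[F2] U} {f : W → U} (h : Represents b n c f) :
    ∃ t : κ → MvPolynomial ι F2, (∀ k, (t k).IsHomogeneous n) ∧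
      (∀ w k, evalAt b w (t k) = m.repr (f w) k) ∧ c = ∑ k, toA b Q (t k) ⊗ₜ[F2] m k := by
  obtain ⟨T, hT, hf, rfl⟩ := h
  obtain ⟨t, ht, rfl⟩ := exists_coordinates m n hT
  refine ⟨t, ht, fun w k => ?_, ?_⟩
  · rw [← hf]
    classical
    simp [Finsupp.single_apply]
  · rw [map_sum]
    rfl

theorem represents_of_coordinates [Fintype κ] (m : Module.Basis κ F2 U) {n : ℕ} {f : W → U}
    {t : κ → MvPolynomial ι F2} (ht : ∀ k, (t k).IsHomogeneous n)
    (hf : ∀ w k, evalAt b w (t k) = m.repr (f w) k) :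
    Represents (Q := Q) b n (∑ k, toA b Q (t k) ⊗ₜ[F2] m k) f := by
  refine ⟨∑ k, t k ⊗ₜ[F2] m k, sum_mem fun k _ => ?_, fun w => ?_, ?_⟩
  · exact ⟨(⟨t k, ht k⟩ : MvPolynomial.homogeneousSubmodule ι F2 n) ⊗ₜ m k, rfl⟩
  · rw [map_sum, map_sum, ← m.sum_repr (f w)]
    exact Finset.sum_congr rfl fun k _ => by rw [← hf]; rfl
  · rw [map_sum]
    rfl

theorem Represents.add {n : ℕ} {c c' : AlgA b Q ⊗[F2] U} {f f' : W → U}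
    (h : Represents b n c f) (h' : Represents b n c' f') :
    Represents b n (c + c') (fun w => f w + f' w) := by
  obtain ⟨T, hT, hf, rfl⟩ := h
  obtain ⟨T', hT', hf', rfl⟩ := h'
  exact ⟨T + T', add_mem hT hT', fun w => by rw [map_add, map_add, hf, hf'], map_add _ _ _⟩

theorem Represents.sub {n : ℕ} {c c' : AlgA b Q ⊗[F2] U} {f f' : W → U}
    (h : Represents b n c f) (h' : Represents b n c' f') :
    Represents b n (c - c') (fun w => f w - f' w) := by
  obtain ⟨T, hT, hf, rfl⟩ := h
  obtain ⟨T', hT', hf', rfl⟩ := h'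
  exact ⟨T - T', sub_mem hT hT', fun w => by rw [map_sub, map_sub, hf, hf'], map_sub _ _ _⟩

theorem Represents.mem_cochains {n : ℕ} {c : AlgA b Q ⊗[F2] U} {f : W → U}
    (h : Represents b n c f) : c ∈ cochains b Q U n := by
  obtain ⟨T, ⟨S, rfl⟩, -, rfl⟩ := h
  induction S using TensorProduct.induction_on with
  | zero => rw [map_zero, map_zero]; exact zero_mem _
  | add x y hx hy => rw [map_add, map_add]; exact add_mem hx hy
  | tmul p u => exact tmul_mem_cochains b p.2 u

theorem exists_lift_of_mem_cochains {n : ℕ} {c : AlgA b Q ⊗[F2] U} (hc : c ∈ cochains b Q U n) :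
    ∃ T ∈ LinearMap.range ((MvPolynomial.homogeneousSubmodule ι F2 n).subtype.rTensor U),
      (toA b Q).toLinearMap.rTensor U T = c := by
  obtain ⟨S, rfl⟩ := hc
  induction S using TensorProduct.induction_on with
  | zero => exact ⟨0, zero_mem _, by rw [map_zero, map_zero]⟩
  | add x y hx hy =>
    obtain ⟨T, hT, hx⟩ := hx
    obtain ⟨T', hT', hy⟩ := hy
    exact ⟨T + T', add_mem hT hT', by rw [map_add, map_add, hx, hy]⟩
  | tmul a u =>
    obtain ⟨_, p, hp, rfl⟩ := a
    exact ⟨p ⊗ₜ u, ⟨(⟨p, hp⟩ : MvPolynomial.homogeneousSubmodule ι F2 n) ⊗ₜ u, rfl⟩, rfl⟩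

/-- Every cochain of degree two represents a quadratic map. -/
theorem exists_quadraticMap_of_mem_cochains [Module.Finite F2 U] {c : AlgA b Q ⊗[F2] U}
    (hc : c ∈ cochains b Q U 2) : ∃ f : QuadraticMap F2 W U, Represents b 2 c f := by
  obtain ⟨T, hT, rfl⟩ := exists_lift_of_mem_cochains b hc
  let m := Module.finBasis F2 U
  obtain ⟨t, ht, rfl⟩ := exists_coordinates m 2 hT
  choose g hg using fun k => exists_quadraticMap_of_polynomial b (ht k)
  refine ⟨∑ k, (LinearMap.toSpanSingleton F2 U (m k)).compQuadraticMap (g k), _, hT,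
    fun w => ?_, rfl⟩
  rw [map_sum, map_sum, _root_.sum_apply]
  exact Finset.sum_congr rfl fun k _ => congrArg (· • m k) (hg k w).symm

/-- Every quadratic map is represented by a cochain of degree two. -/
theorem exists_represents [Fintype ι] [Module.Finite F2 U] (Q : QuadraticMap F2 W V)
    (f : QuadraticMap F2 W U) : ∃ c, Represents (Q := Q) b 2 c f := by
  let m := Module.finBasis F2 U
  choose t ht hf using fun k => exists_polynomial_of_quadraticMap b
    ((m.coord k).compQuadraticMap f)
  exact ⟨_, represents_of_coordinates b m ht fun w k => hf k w⟩

/-- A cochain of degree two vanishes in `A^2(Q) ⊗ U` if and only if the quadratic map which it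
represents factors linearly through `Q`. -/
theorem Represents.eq_zero_iff [Module.Finite F2 U] {c : AlgA b Q ⊗[F2] U} {f : W → U}
    (h : Represents b 2 c f) : c = 0 ↔ ∃ ν : V →ₗ[F2] U, ∀ w, f w = ν (Q w) := by
  let m := Module.finBasis F2 U
  obtain ⟨t, ht, hf, rfl⟩ := exists_represents_coordinates b m h
  rw [sum_tmul_basis_eq_zero_iff]
  simp only [Ideal.Quotient.mkₐ_eq_mk, Ideal.Quotient.eq_zero_iff_mem]
  constructor
  · intro h0
    choose φ hφ using fun k => exists_isComponent_of_mem b Q (ht k) (h0 k)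
    refine ⟨∑ k, (φ k).smulRight (m k), fun w => m.repr.injective ?_⟩
    ext k
    rw [← hf, (hφ k).2, LinearMap.sum_apply]
    classical
    simp [Finsupp.single_apply]
  · rintro ⟨ν, hν⟩ k
    exact mem_classIdeal_of_isComponent (φ := m.coord k ∘ₗ ν)
      ⟨ht k, fun w => by rw [hf, hν]; rfl⟩

end Coordinates

section Differential

variable {ι κ W V U : Type*} [AddCommGroup W] [Module F2 W] [AddCommGroup V] [Module F2 V]
  [AddCommGroup U] [Module F2 U] [Fintype ι] {Q : QuadraticMap F2 W V}
  (b : Module.Basis ι F2 W) (hQ : IsBocksteinClosed Q) (ρ : Representation U Q)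

theorem delta_sum_tmul_basis [Fintype κ] (m : Module.Basis κ F2 U) (t : κ → MvPolynomial ι F2) :
    delta b hQ ρ (∑ k, toA b Q (t k) ⊗ₜ[F2] m k) =
      ∑ k, toA b Q (deltaCoord b m ρ t k) ⊗ₜ[F2] m k := by
  have hρ : ∀ i l, ρ.onW (b i) (m l) = ∑ k, m.repr (ρ.onW (b i) (m l)) k • m k :=
    fun i l => (m.sum_repr _).symm
  simp only [map_sum, delta_tmul, deltaCoord, map_add, TensorProduct.add_tmul,
    Finset.sum_add_distrib]
  congr 1
  have e : ∀ k, (∑ l, toA b Q (matR b m ρ k l * t l)) ⊗ₜ[F2] m k =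
      ∑ l, ∑ i, toA b Q (MvPolynomial.X i * t l) ⊗ₜ[F2]
        (m.repr (ρ.onW (b i) (m l)) k • m k) := by
    intro k
    simp only [matR, Finset.sum_mul, map_sum, TensorProduct.sum_tmul]
    refine Finset.sum_congr rfl fun l _ => Finset.sum_congr rfl fun i _ => ?_
    rw [mul_assoc, ← MvPolynomial.smul_eq_C_mul, map_smul, TensorProduct.smul_tmul]
  simp only [e]
  conv_rhs => rw [Finset.sum_comm]
  refine Finset.sum_congr rfl fun l _ => ?_
  rw [Finset.sum_comm]
  refine Finset.sum_congr rfl fun i _ => ?_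
  rw [← TensorProduct.tmul_sum, ← hρ]

/-- Over `Q` Bockstein closed, the extension with factor set `f` is Bockstein closed if and only
if `f` is a cocycle. -/
theorem isBocksteinClosed_extQuad_iff_mem_cocycles [Module.Finite F2 U] {c : AlgA b Q ⊗[F2] U}
    {f : QuadraticMap F2 W U} (h : Represents b 2 c f) :
    IsBocksteinClosed (extQuad ρ f) ↔ c ∈ cocycles b hQ ρ 2 := by
  let m := Module.finBasis F2 U
  have hc : c ∈ cochains b Q U 2 := h.mem_cochains
  obtain ⟨t, ht, hf, rfl⟩ := exists_represents_coordinates b m h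
  rw [isBocksteinClosed_extQuad_iff b m ρ hQ ht hf, cocycles, Submodule.mem_inf,
    LinearMap.mem_ker, delta_sum_tmul_basis, sum_tmul_basis_eq_zero_iff]
  simp only [Ideal.Quotient.mkₐ_eq_mk, Ideal.Quotient.eq_zero_iff_mem]
  exact (and_iff_right hc).symm

/-- The cochain of degree one which represents the linear map `lam`. -/
def linCochain (Q : QuadraticMap F2 W V) (lam : W →ₗ[F2] U) : AlgA b Q ⊗[F2] U :=
  ∑ i, toA b Q (MvPolynomial.X i) ⊗ₜ[F2] lam (b i)

theorem linCochain_mem (lam : W →ₗ[F2] U) : linCochain b Q lam ∈ cochains b Q U 1 :=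
  sum_mem fun i _ => tmul_mem_cochains b (MvPolynomial.isHomogeneous_X F2 i) _

theorem eq_sum_X_of_isHomogeneous_one {p : MvPolynomial ι F2} (hp : p.IsHomogeneous 1) :
    p = ∑ i, p.coeff (Finsupp.single i 1) • MvPolynomial.X i := by
  classical
  ext s
  simp only [MvPolynomial.coeff_sum, MvPolynomial.coeff_smul, MvPolynomial.coeff_X, smul_eq_mul]
  by_cases hs : s.degree = 1
  · obtain ⟨j, rfl⟩ := exists_eq_single hs
    simp [Finsupp.single_left_inj]
  · rw [hp.coeff_eq_zero hs]
    refine (Finset.sum_eq_zero fun i _ => ?_).symm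
    rw [if_neg, mul_zero]
    rintro rfl
    simp at hs

theorem exists_eq_linCochain {c : AlgA b Q ⊗[F2] U} (hc : c ∈ cochains b Q U 1) :
    ∃ lam : W →ₗ[F2] U, c = linCochain b Q lam := by
  obtain ⟨S, rfl⟩ := hc
  induction S using TensorProduct.induction_on with
  | zero => exact ⟨0, by simp [linCochain]⟩
  | add x y hx hy =>
    obtain ⟨lam, hx⟩ := hx
    obtain ⟨lam', hy⟩ := hy
    refine ⟨lam + lam', ?_⟩
    rw [map_add, hx, hy]
    simp [linCochain, TensorProduct.tmul_add, Finset.sum_add_distrib]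
  | tmul a u =>
    obtain ⟨_, p, hp, rfl⟩ := a
    refine ⟨b.constr F2 fun i => p.coeff (Finsupp.single i 1) • u, ?_⟩
    change toA b Q p ⊗ₜ u = _
    conv_lhs => rw [eq_sum_X_of_isHomogeneous_one hp, map_sum, TensorProduct.sum_tmul]
    refine Finset.sum_congr rfl fun i _ => ?_
    rw [map_smul, TensorProduct.smul_tmul, Module.Basis.constr_basis]

theorem represents_delta_linCochain (lam : W →ₗ[F2] U) :
    Represents b 2 (delta b hQ ρ (linCochain b Q lam))
      (fun w => lam w + ρ.onW w (lam w)) := by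
  refine ⟨∑ i, ((MvPolynomial.X i ^ 2) ⊗ₜ[F2] lam (b i) +
    ∑ j, (MvPolynomial.X j * MvPolynomial.X i) ⊗ₜ[F2] ρ.onW (b j) (lam (b i))), ?_, ?_, ?_⟩
  · refine sum_mem fun i _ => add_mem ?_ (sum_mem fun j _ => ?_)
    · have h : (MvPolynomial.X i ^ 2 : MvPolynomial ι F2).IsHomogeneous 2 := by
        simpa using (MvPolynomial.isHomogeneous_X F2 i).pow 2
      exact ⟨(⟨_, h⟩ : MvPolynomial.homogeneousSubmodule ι F2 2) ⊗ₜ lam (b i), rfl⟩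
    · have h : (MvPolynomial.X j * MvPolynomial.X i : MvPolynomial ι F2).IsHomogeneous 2 :=
        (MvPolynomial.isHomogeneous_X F2 j).mul (MvPolynomial.isHomogeneous_X F2 i)
      exact ⟨(⟨_, h⟩ : MvPolynomial.homogeneousSubmodule ι F2 2) ⊗ₜ ρ.onW (b j) (lam (b i)), rfl⟩
  · intro w
    have hlam : lam w = ∑ i, b.repr w i • lam (b i) := by
      conv_lhs => rw [← b.sum_repr w, map_sum]
      simp only [map_smul]
    have hρ : ∀ u, ρ.onW w u = ∑ j, b.repr w j • ρ.onW (b j) u := fun u => by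
      conv_lhs => rw [← b.sum_repr w, map_sum]
      simp only [map_smul, LinearMap.sum_apply, LinearMap.smul_apply]
    simp only [map_sum, map_add, LinearMap.rTensor_tmul, TensorProduct.lid_tmul,
      AlgHom.toLinearMap_apply, Finset.sum_add_distrib, map_mul, evalAt,
      MvPolynomial.aeval_X, pow_two, F2.mul_self]
    rw [← hlam, hlam, map_sum]
    congr 1
    refine Finset.sum_congr rfl fun i _ => ?_
    rw [map_smul, hρ, Finset.smul_sum]
    exact Finset.sum_congr rfl fun j _ => by rw [smul_smul, mul_comm]
  · simp only [linCochain, map_sum, delta_tmul, bockstein_X, map_add]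
    rfl

end Differential

/-! ### Extensions and factor sets -/

section Transfer

variable {ι W₁ V₁ W₂ V₂ : Type*} [AddCommGroup W₁] [Module F2 W₁] [AddCommGroup V₁]
  [Module F2 V₁] [AddCommGroup W₂] [Module F2 W₂] [AddCommGroup V₂] [Module F2 V₂]
  {Q₁ : QuadraticMap F2 W₁ V₁} {Q₂ : QuadraticMap F2 W₂ V₂}

/-- Bockstein closedness is invariant under isomorphism: in corresponding bases the two ideals
coincide. -/
theorem isBocksteinClosed_congr [Finite ι] (b : Module.Basis ι F2 W₁) (φ : QuadHom Q₁ Q₂)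
    (hW : Function.Bijective φ.onW) (hV : Function.Bijective φ.onV) :
    IsBocksteinClosed Q₁ ↔ IsBocksteinClosed Q₂ := by
  let eW := LinearEquiv.ofBijective φ.onW hW
  let eV := LinearEquiv.ofBijective φ.onV hV
  have hcomm : ∀ w, Q₂ (eW w) = eV (Q₁ w) := φ.comm
  have heval : ∀ w p, evalAt (b.map eW) (eW w) p = evalAt b w p := fun w p => by
    simp [evalAt]
  have hideal : classIdeal b Q₁ = classIdeal (b.map eW) Q₂ := by
    apply le_antisymm
    · refine Ideal.span_le.2 fun p ⟨ψ, hp, hψ⟩ => ?_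
      refine mem_classIdeal_of_isComponent (φ := ψ ∘ₗ eV.symm.toLinearMap) ⟨hp, fun w => ?_⟩
      obtain ⟨w, rfl⟩ := eW.surjective w
      rw [heval, hψ, hcomm, LinearMap.comp_apply, LinearEquiv.coe_coe, eV.symm_apply_apply]
    · refine Ideal.span_le.2 fun p ⟨ψ, hp, hψ⟩ => ?_
      refine mem_classIdeal_of_isComponent (φ := ψ ∘ₗ eV.toLinearMap) ⟨hp, fun w => ?_⟩
      rw [← heval, hψ, hcomm]
      rfl
  rw [isBocksteinClosed_iff b, isBocksteinClosed_iff (b.map eW), hideal]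

end Transfer

section FactorSets

variable {W V U : Type u} [AddCommGroup W] [Module F2 W] [AddCommGroup V] [Module F2 V]
  [AddCommGroup U] [Module F2 U] {Q : QuadraticMap F2 W V}

/-- The extension with middle term `U × W → U × V` which has `f` as a factor set. -/
def extOf (ρ : Representation U Q) (f : QuadraticMap F2 W U) : AbExt Q U where
  domW := U × W
  codV := U × V
  quad := extQuad ρ f
  i := ⟨LinearMap.inl F2 U W, LinearMap.inl F2 U V, fun u => by
    rw [extQuad_apply]
    simp [idQuad]⟩
  π := ⟨LinearMap.snd F2 U W, LinearMap.snd F2 U V, fun x => by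
    rw [extQuad_apply]
    rfl⟩
  injW := LinearMap.inl_injective
  injV := LinearMap.inl_injective
  surjW := LinearMap.snd_surjective
  surjV := LinearMap.snd_surjective
  exactW := LinearMap.range_inl F2 U W
  exactV := LinearMap.range_inl F2 U V

theorem extOf_hasAction (ρ : Representation U Q) (f : QuadraticMap F2 W U) :
    (extOf ρ f).HasAction ρ := by
  rintro u ⟨u', w⟩
  change ((ρ.onW w u, 0) : U × V) =
    extQuad ρ f (u + u', 0 + w) - extQuad ρ f (u, 0) - extQuad ρ f (u', w)
  simp only [extQuad_apply]
  ext
  · simp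
    abel
  · simp

theorem extOf_isFactorSet (ρ : Representation U Q) (f : QuadraticMap F2 W U) :
    (extOf ρ f).IsFactorSet f := by
  refine ⟨LinearMap.inr F2 U W, LinearMap.inr F2 U V, fun _ => rfl, fun _ => rfl, fun w => ?_⟩
  refine (extQuad_apply ρ f (0, w)).trans (Prod.ext ?_ (zero_add (Q w)).symm)
  change 0 + ρ.onW w 0 + f w = f w + 0
  simp

theorem AbExt.exists_isFactorSet (E : AbExt Q U) : ∃ f, E.IsFactorSet f := by
  obtain ⟨sW, hW⟩ := E.π.onW.exists_rightInverse_of_surjective (LinearMap.range_eq_top.2 E.surjW)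
  obtain ⟨sV, hV⟩ := E.π.onV.exists_rightInverse_of_surjective (LinearMap.range_eq_top.2 E.surjV)
  have hW' : ∀ w, E.π.onW (sW w) = w := fun w => DFunLike.congr_fun hW w
  have hV' : ∀ v, E.π.onV (sV v) = v := fun v => DFunLike.congr_fun hV v
  have h : ∀ w, ∃ u, E.i.onV u = E.quad (sW w) - sV (Q w) := fun w => by
    rw [← LinearMap.mem_range, E.exactV, LinearMap.mem_ker, map_sub, hV', ← E.π.comm, hW', sub_self]
  choose f hf using h
  exact ⟨f, sW, sV, hW', hV', fun w => by rw [hf, sub_add_cancel]⟩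

/-- An extension with factor set `f` is equivalent to the standard one; in particular `f` is a
quadratic map. -/
theorem AbExt.IsFactorSet.exists_equivalent {E : AbExt Q U} {ρ : Representation U Q}
    (hE : E.HasAction ρ) {f : W → U} (hf : E.IsFactorSet f) :
    ∃ F : QuadraticMap F2 W U, (∀ w, F w = f w) ∧ (extOf ρ F).Equivalent E := by
  obtain ⟨sW, sV, hW, hV, h⟩ := hf
  obtain ⟨r, hr⟩ := E.i.onV.exists_leftInverse_of_injective (LinearMap.ker_eq_bot.2 E.injV)
  have hr' : ∀ u, r (E.i.onV u) = u := fun u => DFunLike.congr_fun hr u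
  let F : QuadraticMap F2 W U := r.compQuadraticMap (E.quad.comp sW - sV.compQuadraticMap Q)
  have hF : ∀ w, F w = f w := fun w => by
    change r (E.quad (sW w) - sV (Q w)) = f w
    rw [h, add_sub_cancel_right, hr']
  refine ⟨F, hF, ⟨E.i.onW.coprod sW, E.i.onV.coprod sV, fun x => ?_⟩, fun u => ?_, fun u => ?_,
    fun x => ?_, fun x => ?_⟩
  · obtain ⟨u, w⟩ : U × W := x
    change E.quad (E.i.onW u + sW w) = E.i.onV.coprod sV (extQuad ρ F (u, w))
    rw [quad_add E hE, hW, h, extQuad_apply, LinearMap.coprod_apply, hF]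
    simp only [map_add]
    abel
  · change E.i.onW u + sW 0 = _
    rw [map_zero, add_zero]
  · change E.i.onV u + sV 0 = _
    rw [map_zero, add_zero]
  · change E.π.onW (E.i.onW x.1 + sW x.2) = x.2
    rw [map_add, map_range E.exactW, hW, zero_add]
  · change E.π.onV (E.i.onV x.1 + sV x.2) = x.2
    rw [map_add, map_range E.exactV, hV, zero_add]

/-- Two standard extensions are equivalent if and only if their factor sets differ by the
coboundary of a linear map `W → U` (the choice of `s_W`) and a linear map applied to `Q` (the choice
of `s_V`). -/
theorem extOf_equivalent_iff (ρ : Representation U Q) (f f' : QuadraticMap F2 W U) :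
    (extOf ρ f).Equivalent (extOf ρ f') ↔ ∃ (lam : W →ₗ[F2] U) (ν : V →ₗ[F2] U),
      ∀ w, f w - f' w - (lam w + ρ.onW w (lam w)) = ν (Q w) := by
  constructor
  · rintro ⟨φ, -, h2, h3, -⟩
    let φW : U × W →ₗ[F2] U × W := φ.onW
    let φV : U × V →ₗ[F2] U × V := φ.onV
    have hi : ∀ u, φV (u, 0) = (u, 0) := h2
    have hπ : ∀ x, (φW x).2 = x.2 := h3
    refine ⟨LinearMap.fst F2 U W ∘ₗ φW ∘ₗ LinearMap.inr F2 U W,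
      -(LinearMap.fst F2 U V ∘ₗ φV ∘ₗ LinearMap.inr F2 U V), fun w => ?_⟩
    have h : extQuad ρ f' (φW (0, w)) = φV (extQuad ρ f (0, w)) := φ.comm (0, w)
    have e : extQuad ρ f (0, w) = (f w, 0) + (0, Q w) := by
      rw [extQuad_apply]
      simp
    rw [e, map_add, hi, extQuad_apply, hπ] at h
    have h1 : (φW (0, w)).1 + ρ.onW w (φW (0, w)).1 + f' w = f w + (φV (0, Q w)).1 :=
      congrArg Prod.fst h
    change f w - f' w - ((φW (0, w)).1 + ρ.onW w (φW (0, w)).1) = -(φV (0, Q w)).1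
    rw [eq_neg_iff_add_eq_zero, sub_sub, sub_add_eq_add_sub, ← h1]
    abel
  · rintro ⟨lam, ν, h⟩
    refine ⟨⟨(LinearMap.fst F2 U W + lam ∘ₗ LinearMap.snd F2 U W).prod (LinearMap.snd F2 U W),
      (LinearMap.fst F2 U V - ν ∘ₗ LinearMap.snd F2 U V).prod (LinearMap.snd F2 U V),
      fun x => ?_⟩, fun u => ?_, fun u => ?_, fun _ => rfl, fun _ => rfl⟩
    · obtain ⟨u, w⟩ : U × W := x
      change extQuad ρ f' (u + lam w, w) =
        ((extQuad ρ f (u, w)).1 - ν (extQuad ρ f (u, w)).2, (extQuad ρ f (u, w)).2)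
      simp only [extQuad_apply, ← h, map_add]
      refine Prod.ext ?_ rfl
      change u + lam w + (ρ.onW w u + ρ.onW w (lam w)) + f' w =
        u + ρ.onW w u + f w - (f w - f' w - (lam w + ρ.onW w (lam w)))
      abel
    · change (u + lam 0, (0 : W)) = (u, 0)
      rw [map_zero, add_zero]
    · change (u - ν 0, (0 : V)) = (u, 0)
      rw [map_zero, sub_zero]

theorem AbExt.Equivalent.isBocksteinClosed_iff {ι : Type*} [Finite ι] {E E' : AbExt Q U}
    (h : E.Equivalent E') (b : Module.Basis ι F2 E.domW) :
    IsBocksteinClosed E.quad ↔ IsBocksteinClosed E'.quad := by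
  obtain ⟨φ, h1, h2, h3, h4⟩ := h
  exact isBocksteinClosed_congr b φ (bijective_of_ses φ.onW E'.injW E.surjW E.exactW E'.exactW h1 h3)
    (bijective_of_ses φ.onV E'.injV E.surjV E.exactV E'.exactV h2 h4)

/-- The sum of two factor sets is a factor set of the Baer sum. -/
theorem baerSum_isFactorSet {E₁ E₂ : AbExt Q U} {ρ : Representation U Q} (h₁ : E₁.HasAction ρ)
    (h₂ : E₂.HasAction ρ) {f₁ f₂ : W → U} (hf₁ : E₁.IsFactorSet f₁) (hf₂ : E₂.IsFactorSet f₂) :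
    (baerSum E₁ E₂ h₁ h₂).IsFactorSet fun w => f₁ w + f₂ w := by
  obtain ⟨sW₁, sV₁, hW₁, hV₁, e₁⟩ := hf₁
  obtain ⟨sW₂, sV₂, hW₂, hV₂, e₂⟩ := hf₂
  refine ⟨(antidiag E₁.i.onW E₂.i.onW E₁.π.onW E₂.π.onW).mkQ ∘ₗ
      (sW₁.prod sW₂).codRestrict (fibre E₁.π.onW E₂.π.onW)
        (fun w => (hW₁ w).trans (hW₂ w).symm),
    (antidiag E₁.i.onV E₂.i.onV E₁.π.onV E₂.π.onV).mkQ ∘ₗ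
      (sV₁.prod sV₂).codRestrict (fibre E₁.π.onV E₂.π.onV)
        (fun v => (hV₁ v).trans (hV₂ v).symm), hW₁, hV₁, fun w => ?_⟩
  -- the difference `[(-i₁ f₂, i₂ f₂)]` lies in the antidiagonal copy of `U`
  refine (Submodule.Quotient.eq _).2 (mem_antidiag.2 ⟨-f₂ w, ?_, ?_⟩)
  · change E₁.i.onV (-f₂ w) = E₁.quad (sW₁ w) - (E₁.i.onV (f₁ w + f₂ w) + sV₁ (Q w))
    rw [e₁, map_neg, map_add]
    abel
  · change -E₂.i.onV (-f₂ w) = E₂.quad (sW₂ w) - (0 + sV₂ (Q w))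
    rw [e₂, map_neg]
    abel

variable [Module.Finite F2 U] {ι : Type v} [Fintype ι] (b : Module.Basis ι F2 W)
  (hQ : IsBocksteinClosed Q)

/-- An extension is Bockstein closed if and only if its factor sets are cocycles. -/
theorem AbExt.isBocksteinClosed_iff_mem_cocycles {E : AbExt Q U} {ρ : Representation U Q}
    (hE : E.HasAction ρ) {f : W → U} (hf : E.IsFactorSet f) {c : AlgA b Q ⊗[F2] U}
    (hc : Represents b 2 c f) : IsBocksteinClosed E.quad ↔ c ∈ cocycles b hQ ρ 2 := by
  obtain ⟨F, hF, h⟩ := hf.exists_equivalent hE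
  obtain rfl : ⇑F = f := funext hF
  rw [← isBocksteinClosed_extQuad_iff_mem_cocycles b hQ ρ hc]
  exact (h.isBocksteinClosed_iff ((Module.finBasis F2 U).prod b)).symm

/-- Two extensions are equivalent if and only if their factor sets are cohomologous. -/
theorem AbExt.equivalent_iff_sub_mem_coboundaries {E E' : AbExt Q U} {ρ : Representation U Q}
    (hE : E.HasAction ρ) (hE' : E'.HasAction ρ) {f f' : W → U} (hf : E.IsFactorSet f)
    (hf' : E'.IsFactorSet f') {c c' : AlgA b Q ⊗[F2] U} (hc : Represents b 2 c f)
    (hc' : Represents b 2 c' f') : E.Equivalent E' ↔ c - c' ∈ coboundaries b hQ ρ 2 := by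
  obtain ⟨F, hF, h⟩ := hf.exists_equivalent hE
  obtain ⟨F', hF', h'⟩ := hf'.exists_equivalent hE'
  obtain rfl : ⇑F = f := funext hF
  obtain rfl : ⇑F' = f' := funext hF'
  have key : ∀ lam : W →ₗ[F2] U, c - c' - delta b hQ ρ (linCochain b Q lam) = 0 ↔
      ∃ ν : V →ₗ[F2] U, ∀ w, F w - F' w - (lam w + ρ.onW w (lam w)) = ν (Q w) := fun lam =>
    ((hc.sub b hc').sub b (represents_delta_linCochain b hQ ρ lam)).eq_zero_iff
  have hmodel : E.Equivalent E' ↔ (extOf ρ F).Equivalent (extOf ρ F') :=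
    ⟨fun e => (h.trans e).trans h'.symm, fun e => (h.symm.trans e).trans h'⟩
  rw [hmodel, extOf_equivalent_iff]
  constructor
  · rintro ⟨lam, hlam⟩
    exact ⟨linCochain b Q lam, linCochain_mem b lam, (sub_eq_zero.1 ((key lam).2 hlam)).symm⟩
  · rintro ⟨d, hd, hd'⟩
    obtain ⟨lam, rfl⟩ := exists_eq_linCochain b hd
    exact ⟨lam, (key lam).1 (sub_eq_zero.2 hd'.symm)⟩

end FactorSets

/-! ### The classification of extensions -/

section Classification

variable {W V U : Type u} [AddCommGroup W] [Module F2 W] [AddCommGroup V] [Module F2 V]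
  [AddCommGroup U] [Module F2 U] {Q : QuadraticMap F2 W V}
  {ι : Type v} [Fintype ι] (b : Module.Basis ι F2 W) (hQ : IsBocksteinClosed Q)
  {ρ : Representation U Q}

theorem cohClass_eq_iff {c c' : AlgA b Q ⊗[F2] U} (hc : c ∈ cocycles b hQ ρ 2)
    (hc' : c' ∈ cocycles b hQ ρ 2) :
    cohClass b hQ ρ c hc = cohClass b hQ ρ c' hc' ↔ c - c' ∈ coboundaries b hQ ρ 2 :=
  Submodule.Quotient.eq _

variable [Module.Finite F2 U]

theorem BExt.exists_cocycle (E : BExt ρ) : ∃ (c : AlgA b Q ⊗[F2] U) (f : W → U),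
    E.ext.IsFactorSet f ∧ Represents b 2 c f ∧ c ∈ cocycles b hQ ρ 2 := by
  obtain ⟨f, hf⟩ := E.ext.exists_isFactorSet
  obtain ⟨F, hF, -⟩ := hf.exists_equivalent E.hasAction
  obtain rfl : ⇑F = f := funext hF
  obtain ⟨c, hc⟩ := exists_represents b Q F
  exact ⟨c, F, hf, hc, (AbExt.isBocksteinClosed_iff_mem_cocycles b hQ E.hasAction hf hc).1 E.closed⟩

/-- The cohomology class of a factor set of the extension `E`. -/
def BExt.cohomologyClass (E : BExt ρ) : Cohomology b hQ ρ 2 :=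
  cohClass b hQ ρ (E.exists_cocycle b hQ).choose (E.exists_cocycle b hQ).choose_spec.choose_spec.2.2

theorem BExt.cohomologyClass_eq (E : BExt ρ) {c : AlgA b Q ⊗[F2] U} {f : W → U}
    (hf : E.ext.IsFactorSet f) (hc : Represents b 2 c f) (hc' : c ∈ cocycles b hQ ρ 2) :
    E.cohomologyClass b hQ = cohClass b hQ ρ c hc' := by
  have h := (E.exists_cocycle b hQ).choose_spec.choose_spec
  exact (cohClass_eq_iff b hQ _ _).2 ((AbExt.equivalent_iff_sub_mem_coboundaries b hQ E.hasAction
    E.hasAction h.1 hf h.2.1 hc).1 (.refl _))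

theorem BExt.cohomologyClass_eq_iff (E E' : BExt ρ) :
    E.cohomologyClass b hQ = E'.cohomologyClass b hQ ↔ E.ext.Equivalent E'.ext := by
  obtain ⟨c, f, hf, hc, hc'⟩ := E.exists_cocycle b hQ
  obtain ⟨d, g, hg, hd, hd'⟩ := E'.exists_cocycle b hQ
  rw [E.cohomologyClass_eq b hQ hf hc hc', E'.cohomologyClass_eq b hQ hg hd hd', cohClass_eq_iff,
    AbExt.equivalent_iff_sub_mem_coboundaries b hQ E.hasAction E'.hasAction hf hg hc hd]

theorem BExt.exists_cohomologyClass_eq (x : Cohomology b hQ ρ 2) :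
    ∃ E : BExt ρ, E.cohomologyClass b hQ = x := by
  obtain ⟨⟨c, hc⟩, rfl⟩ := Submodule.Quotient.mk_surjective _ x
  obtain ⟨f, hf⟩ := exists_quadraticMap_of_mem_cochains b hc.1
  exact ⟨⟨extOf ρ f, extOf_hasAction ρ f,
    (isBocksteinClosed_extQuad_iff_mem_cocycles b hQ ρ hf).2 hc⟩,
    BExt.cohomologyClass_eq b hQ _ (extOf_isFactorSet ρ f) hf hc⟩

/-- The bijection between `Ext(Q, U)` and `H^2(Q, U)` given by factor sets. -/
def extEquivCohomology : Ext ρ ≃ Cohomology b hQ ρ 2 :=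
  Equiv.ofBijective
    (Quotient.lift (fun E : BExt ρ => E.cohomologyClass b hQ)
      fun E E' h => (E.cohomologyClass_eq_iff b hQ E').2 h)
    ⟨fun x y => Quotient.inductionOn₂ x y fun E E' h =>
        Quotient.sound ((E.cohomologyClass_eq_iff b hQ E').1 h),
      fun x => (BExt.exists_cohomologyClass_eq b hQ x).imp' BExt.cls fun _ h => h⟩

theorem isBocksteinClosed_baerSum {ι : Type v} [Fintype ι] (b : Module.Basis ι F2 W)
    (hQ : IsBocksteinClosed Q) (E₁ E₂ : BExt ρ) :
    IsBocksteinClosed (baerSum E₁.ext E₂.ext E₁.hasAction E₂.hasAction).quad := by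
  obtain ⟨c, f, hf, hc, hc'⟩ := E₁.exists_cocycle b hQ
  obtain ⟨d, g, hg, hd, hd'⟩ := E₂.exists_cocycle b hQ
  exact (AbExt.isBocksteinClosed_iff_mem_cocycles b hQ (baerSum_hasAction _ _ _ _)
    (baerSum_isFactorSet E₁.hasAction E₂.hasAction hf hg) (hc.add b hd)).2 (add_mem hc' hd')

theorem cohomologyClass_baerSum (E₁ E₂ : BExt ρ)
    (h : IsBocksteinClosed (baerSum E₁.ext E₂.ext E₁.hasAction E₂.hasAction).quad) :
    BExt.cohomologyClass b hQ ⟨baerSum E₁.ext E₂.ext E₁.hasAction E₂.hasAction,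
        baerSum_hasAction E₁.ext E₂.ext E₁.hasAction E₂.hasAction, h⟩ =
      E₁.cohomologyClass b hQ + E₂.cohomologyClass b hQ := by
  obtain ⟨c, f, hf, hc, hc'⟩ := E₁.exists_cocycle b hQ
  obtain ⟨d, g, hg, hd, hd'⟩ := E₂.exists_cocycle b hQ
  rw [E₁.cohomologyClass_eq b hQ hf hc hc', E₂.cohomologyClass_eq b hQ hg hd hd',
    BExt.cohomologyClass_eq b hQ _ (baerSum_isFactorSet E₁.hasAction E₂.hasAction hf hg)
      (hc.add b hd) (add_mem hc' hd')]
  rfl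

end Classification

end

end QuadCoh

theorem mainTheorem5 {W V U : Type u} [AddCommGroup W] [Module QuadCoh.F2 W]
    [AddCommGroup V] [Module QuadCoh.F2 V] [AddCommGroup U] [Module QuadCoh.F2 U]
    [Module.Finite QuadCoh.F2 V] [Module.Finite QuadCoh.F2 U]
    {ι : Type v} [Fintype ι] (b : Module.Basis ι QuadCoh.F2 W)
    (Q : QuadraticMap QuadCoh.F2 W V) (hQ : QuadCoh.IsBocksteinClosed Q)
    (ρ : QuadCoh.Representation U Q) :
    ∃ _ : AddCommGroup (QuadCoh.Ext ρ),
      (∀ E₁ E₂ : QuadCoh.BExt ρ,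
        ∃ h : QuadCoh.IsBocksteinClosed
            (QuadCoh.baerSum E₁.ext E₂.ext E₁.hasAction E₂.hasAction).quad,
          E₁.cls + E₂.cls =
            QuadCoh.BExt.cls ⟨QuadCoh.baerSum E₁.ext E₂.ext E₁.hasAction E₂.hasAction,
              QuadCoh.baerSum_hasAction E₁.ext E₂.ext E₁.hasAction E₂.hasAction, h⟩) ∧
      ∃ Φ : QuadCoh.Cohomology b hQ ρ 2 ≃+ QuadCoh.Ext ρ,
        ∀ (E : QuadCoh.BExt ρ) (f : W → U) (c), E.ext.IsFactorSet f →
          QuadCoh.Represents (Q := Q) b 2 c f →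
            ∃ hc : c ∈ QuadCoh.cocycles b hQ ρ 2, Φ (QuadCoh.cohClass b hQ ρ c hc) = E.cls := by
  let e : QuadCoh.Ext ρ ≃ QuadCoh.Cohomology b hQ ρ 2 := QuadCoh.extEquivCohomology b hQ
  refine ⟨e.addCommGroup, fun E₁ E₂ => ?_, ?_⟩
  · have h := QuadCoh.isBocksteinClosed_baerSum b hQ E₁ E₂
    exact ⟨h, (e.eq_symm_apply.2 (QuadCoh.cohomologyClass_baerSum b hQ E₁ E₂ h)).symm⟩
  · let := e.addCommGroup
    refine ⟨e.addEquiv.symm, fun E f c hf hc => ?_⟩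
    have hc' := (QuadCoh.AbExt.isBocksteinClosed_iff_mem_cocycles b hQ E.hasAction hf hc).1 E.closed
    exact ⟨hc', e.symm_apply_eq.2 (E.cohomologyClass_eq b hQ hf hc hc').symm⟩
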